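/- **Theorem (transport-entropy inequalities for stochastic approximation algorithms).** Let $d\ge 1$, let $\mu$ be a probability measure on $\mathbb R^q$, and let $H:\mathbb R^d\times\mathbb R^q\to\mathbb R^d$ be Borel. Let $(U_n)_{n\ge1}$ be i.i.d. with law $\mu$, $U\sim\mu$, $h(\theta):=\mathbb E[H(\theta,U)]$, $\theta_0\in\mathbb R^d$, and $\theta_{n+1}=\theta_n-\gamma_{n+1}H(\theta_n,U_{n+1})$, $n\ge0$. Let $\alpha\in[\frac12,1]$ and assume: * **(STEP)** $\gamma_n\ge0$ for $n\ge1$, $\sum_{n\ge1}\gamma_n=+\infty$, $\sum_{n\ge1}\gamma_n^2<+\infty$. * **GC($\beta$)**, for some $\beta>0$: every $1$-Lipschitz $f:\mathbb R^q\to\mathbb R$ satisfies $\mathbb E[e^{\lambda f(U)}]\le e^{\lambda\mathbb E[f(U)]+\beta\lambda^2/4}$ for all $\lambda\ge0$ (both expectations being finite). * **(HL)** There is $C_H>0$ with $|H(\theta,u)-H(\theta',u)|\le C_H(1+|u|)|\theta-\theta'|$ for all $\theta,\theta',u$. * **(HLS$_\alpha$)** There are a $C^2$ function $L:\mathbb R^d\to(0,\infty)$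 and constants $C_L,C_h,C_\alpha>0$ with $|\nabla L|^2\le C_LL$, $\eta:=\frac12\sup_x\|\nabla^2L(x)\|<\infty$ (operator norm), $\langle h,\nabla L\rangle\ge0$, $|h|^2\le C_hL$, and $|H(\theta,u)-H(\theta,u')|\le C_\alpha L(\theta)^{\frac{1-\alpha}2}|u-u'|$ for all $\theta,u,u'$. * **(HUA)** $h$ is $C^1$ and there is $\underline\lambda>0$ with $\underline\lambda|\xi|^2\le\langle Dh(\theta)\xi,\xi\rangle$ for all $\theta,\xi$. Let $N\ge1$. *Rates.* Put $C_{H,\mu}:=2C_H^2(1+\mathbb E|U|^2)$, $\Pi_{1,n}:=\prod_{k=0}^{n-1}(1-2\underline\lambda\gamma_{k+1}+C_{H,\mu}\gamma_{k+1}^2)$, $S_N:=\sum_{k=0}^{N-1}\frac1{(k+1)\log^2(k+4)}$, and $$C^\gamma_N:=\sum_{k=0}^{N-1}\gamma_{k+1}^2\frac{\Pi_{1,N}}{\Pi_{1,k}},\qquad C^{\gamma,\alpha}_N:=\sum_{k=0}^{N-1}\gamma_{k+1}^{\frac{2\alpha}{2\alpha-1}}\Big(\frac{\Pi_{1,N}}{\Pi_{1,k}}\Big)^{\frac{\alpha}{2\alpha-1}}\big((k+1)\log^2(k+4)\big)^{\frac{1-\alpha}{2\alpha-1}}\quad(\alpha>\tfrac12),$$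 $$\tilde s_N:=\max_{0\le k\le N-1}(k+1)^{1/2}\log(k+4)\,\gamma_{k+1}\Big(\frac{\Pi_{1,N}}{\Pi_{1,k}}\Big)^{1/2}e^{S_N}.$$ *Constants.* Put $\Gamma_N:=\sum_{k=0}^{N-1}\gamma_{k+1}^2$, $G_N:=\max(1,\gamma_1^2,\dots,\gamma_N^2)$, $\Pi_{2,N}:=\prod_{k=0}^{N-1}\big(1+(2\eta\alpha C_h+\frac\beta2\alpha^2C_LC_\alpha^2)\gamma_{k+1}^2\big)$, $\underline C:=4\eta\alpha C_\alpha^2\mathbb E|U|^2$, $\varepsilon_\beta:=\frac1{2\beta}$, $\Lambda_N:=\Pi_{2,N}^{-1}\min\big(1,\frac{\varepsilon_\beta}{8\eta\alpha C_\alpha^2G_N}\big)$, $\bar\rho_N:=\Lambda_N/2$. For $\alpha\in(\frac12,1]$, $$\Psi_N:=\tfrac{2\alpha-1}{\alpha}\bar\rho_N^{-\frac{1-\alpha}{2\alpha-1}}+\big(L^\alpha(\theta_0)+\underline C\,\Gamma_N\big)\Pi_{2,N}\,\bar\rho_N\tfrac{1-\alpha}{\alpha}+\tfrac12\Gamma_N\log\mathbb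 E\Big[e^{\frac{\varepsilon_\beta(1-\alpha)}{2\alpha}|U|^2}\Big],$$ $$\varphi_\alpha:=e^{\Psi_N}\,2^{\frac{2\alpha}{2\alpha-1}}\Big(\tfrac{\beta C_\alpha^2}4\vee\big(\tfrac{\beta C_\alpha^2}4\big)^{\frac{\alpha}{2\alpha-1}}\Big)e^{\frac{S_N}{2\alpha-1}},$$ and for $\alpha=\frac12$, $$\lambda_*:=\Big(\frac{\Lambda_N}{\beta C_{1/2}^2}\Big)^{1/2},\qquad \varphi_{1/2}:=\tfrac14e^{S_N}\Big(\Lambda_N\Pi_{2,N}\big(L^{1/2}(\theta_0)+\underline C\,\Gamma_N\big)+\tfrac12\Gamma_N\log\mathbb E\big[e^{\varepsilon_\beta|U|^2}\big]\Big).$$ Define, for $\rho\ge0$: if $\alpha\in(\frac12,1]$, $$\Phi_{\alpha,N}(\rho):=\varphi_\alpha\big(C^\gamma_N\rho^2\vee C^{\gamma,\alpha}_N\rho^{\frac{2\alpha}{2\alpha-1}}\big);$$ if $\alpha=\frac12$, $$\Phi_{1/2,N}(\rho):=2\varphi_{1/2}C^\gamma_N\frac{(\rho/\lambda_*)^2}{1-\rho\tilde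 s_N/\lambda_*}\ \text{ if }\rho\tilde s_N<\lambda_*,\qquad \Phi_{1/2,N}(\rho):=+\infty\ \text{ otherwise.}$$ Then, with $\Phi^*_{\alpha,N}(r):=\sup_{\rho\ge0}\{r\rho-\Phi_{\alpha,N}(\rho)\}$, the law $\mu_N$ of $\theta_N$ satisfies $T_{\Phi^*_{\alpha,N}}$, that is, for every probability measure $\nu$ on $\mathbb R^d$, $$\Phi^*_{\alpha,N}\big(W_1(\nu,\mu_N)\big)\le\int\log\frac{d\nu}{d\mu_N}\,d\nu,$$ where the right-hand side is $+\infty$ if $\nu\not\ll\mu_N$, and $W_1(\nu,\mu_N)\in[0,\infty]$ is the infimum of $\int|x-y|\,\pi(dx,dy)$ over all couplings $\pi$ of $\nu$ and $\mu_N$. -/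

import Mathlib

open MeasureTheory ProbabilityTheory Finset
open scoped NNReal ENNReal

noncomputable section

/-! ### Wasserstein distance, monotone conjugate, transport-entropy inequalities -/

/-- The Wasserstein distance of order one: the infimum over all couplings `π` of `μ` and `ν` of the
integral of `|x - y|` (with values in `[0, ∞]`, so that it makes sense for all probability
measures). -/
def wasserstein1 {E : Type*} [MeasurableSpace E] [PseudoEMetricSpace E] (μ ν : Measure E) :
    ℝ≥0∞ :=
  ⨅ (π : Measure (E × E)) (_ : π.map Prod.fst = μ ∧ π.map Prod.snd = ν),
    ∫⁻ z, edist z.1 z.2 ∂π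

/-- The monotone conjugate `Φ*(x) = sup_{ρ ≥ 0} (x ρ - Φ(ρ))`. A function `Φ` that is given on a
part of `[0, ∞)` only is extended by `+∞`, so that the supremum is over that part. -/
def monotoneConj (Φ : ℝ≥0 → EReal) (x : ℝ≥0∞) : EReal :=
  ⨆ ρ : ℝ≥0, ((x * (ρ : ℝ≥0∞) : ℝ≥0∞) : EReal) - Φ ρ

/-- `μ` satisfies the transport-entropy inequality `T_Ψ`: for every probability measure `ν`,
`Ψ(W₁(ν, μ)) ≤ H(ν, μ)`, where `H(ν, μ)` is the relative entropy of `ν` with respect to `μ`. -/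
def SatisfiesTransportEntropy {E : Type*} [MeasurableSpace E] [PseudoEMetricSpace E]
    (Ψ : ℝ≥0∞ → EReal) (μ : Measure E) : Prop :=
  ∀ ν : Measure E, IsProbabilityMeasure ν →
    Ψ (wasserstein1 ν μ) ≤ ((InformationTheory.klDiv ν μ : ℝ≥0∞) : EReal)

/-- The Gaussian concentration property `GC(β)`. -/
def GaussianConcentration {E : Type*} [MeasurableSpace E] [PseudoEMetricSpace E]
    (β : ℝ) (μ : Measure E) : Prop :=
  ∀ f : E → ℝ, LipschitzWith 1 f →
    Integrable f μ ∧
    ∀ s : ℝ, 0 ≤ s →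
      Integrable (fun u => Real.exp (s * f u)) μ ∧
      ∫ u, Real.exp (s * f u) ∂μ ≤ Real.exp (s * ∫ u, f u ∂μ + β * s ^ 2 / 4)

/-! ### The Robbins-Monro scheme and its assumptions -/

/-- The data of a Robbins-Monro scheme, together with the Lyapunov function and the real constants
that occur in the assumptions on it. No property is assumed here. -/
structure RMData (d q : ℕ) where
  /-- the function `H(θ, u)` -/
  H : EuclideanSpace ℝ (Fin d) → EuclideanSpace ℝ (Fin q) → EuclideanSpace ℝ (Fin d)
  /-- the law of the innovations -/
  μ : Measure (EuclideanSpace ℝ (Fin q))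
  /-- the starting point -/
  θ₀ : EuclideanSpace ℝ (Fin d)
  /-- the steps `γ 1, γ 2, …` (the value `γ 0` plays no role) -/
  γ : ℕ → ℝ
  /-- the Lyapunov function -/
  L : EuclideanSpace ℝ (Fin d) → ℝ
  /-- the constant of the Gaussian concentration property -/
  β : ℝ
  /-- the exponent of the domination assumption -/
  α : ℝ
  /-- the constant of uniform attractivity -/
  lam : ℝ
  /-- the constant of the Lipschitz assumption on `H` in `θ` -/
  CH : ℝ
  /-- the constant in `|∇L|² ≤ C_L L` -/
  CL : ℝ
  /-- the constant in `|h|² ≤ C_h L` -/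
  Ch : ℝ
  /-- the constant of the Lipschitz assumption on `H` in `u` -/
  Cα : ℝ

namespace RMData

variable {d q : ℕ} (D : RMData d q)

/-- The mean field `h(θ) = E[H(θ, U)]`. -/
def h (θ : EuclideanSpace ℝ (Fin d)) : EuclideanSpace ℝ (Fin d) := ∫ u, D.H θ u ∂D.μ

/-- The recursion `θ_{n+1} = θ_n - γ_{n+1} H(θ_n, U_{n+1})`. -/
def iter {Ω : Type*} (U : ℕ → Ω → EuclideanSpace ℝ (Fin q)) :
    ℕ → Ω → EuclideanSpace ℝ (Fin d)
  | 0, _ => D.θ₀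
  | n + 1, ω => iter U n ω - D.γ (n + 1) • D.H (iter U n ω) (U (n + 1) ω)

/-- The step assumption: `γ_n ≥ 0`, `∑ γ_n = ∞` and `∑ γ_n² < ∞` (sums over `n ≥ 1`). -/
def StepCondition : Prop :=
  (∀ n, 0 ≤ D.γ (n + 1)) ∧
  Filter.Tendsto (fun n => ∑ k ∈ range n, D.γ (k + 1)) Filter.atTop Filter.atTop ∧
  Summable (fun n => D.γ (n + 1) ^ 2)

/-- Assumption (HL), with constant `C_H`. -/
def HL : Prop :=
  0 < D.CH ∧ ∀ u θ θ', ‖D.H θ u - D.H θ' u‖ ≤ D.CH * (1 + ‖u‖) * ‖θ - θ'‖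

/-- `η = (1/2) sup_x ‖∇²L(x)‖`, with the operator norm of the Hessian. -/
def η : ℝ := 1 / 2 * ⨆ x, ‖fderiv ℝ (fderiv ℝ D.L) x‖

/-- Assumption (HLS_α), with Lyapunov function `L` and constants `C_L`, `C_h`, `C_α`. -/
def HLS : Prop :=
  ContDiff ℝ 2 D.L ∧ (∀ θ, 0 < D.L θ) ∧
  0 < D.CL ∧ (∀ θ, ‖gradient D.L θ‖ ^ 2 ≤ D.CL * D.L θ) ∧
  BddAbove (Set.range fun x => ‖fderiv ℝ (fderiv ℝ D.L) x‖) ∧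
  (∀ θ, 0 ≤ inner ℝ (D.h θ) (gradient D.L θ)) ∧
  0 < D.Ch ∧ (∀ θ, ‖D.h θ‖ ^ 2 ≤ D.Ch * D.L θ) ∧
  0 < D.Cα ∧
  ∀ θ u u', ‖D.H θ u - D.H θ u'‖ ≤ D.Cα * D.L θ ^ ((1 - D.α) / 2) * ‖u - u'‖

/-- Assumption (HUA), with constant `lam`. -/
def HUA : Prop :=
  ContDiff ℝ 1 D.h ∧ 0 < D.lam ∧
  ∀ θ ξ, D.lam * ‖ξ‖ ^ 2 ≤ inner ℝ (fderiv ℝ D.h θ ξ) ξ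

/-! ### The concentration rates -/

/-- `E[|U|²]`. -/
def m2 : ℝ := ∫ u, ‖u‖ ^ 2 ∂D.μ

/-- `C_{H,μ} = 2 C_H² (1 + E[|U|²])`. -/
def CHμ : ℝ := 2 * D.CH ^ 2 * (1 + D.m2)

/-- `Π_{1,n} = ∏_{k=0}^{n-1} (1 - 2 lam γ_{k+1} + C_{H,μ} γ_{k+1}²)`. -/
def Pi1 (n : ℕ) : ℝ :=
  ∏ k ∈ range n, (1 - 2 * D.lam * D.γ (k + 1) + D.CHμ * D.γ (k + 1) ^ 2)

/-- The weight `(k+1) log²(k+4)`. -/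
def wt (k : ℕ) : ℝ := ((k : ℝ) + 1) * Real.log ((k : ℝ) + 4) ^ 2

/-- `S_n = ∑_{k=0}^{n-1} 1 / ((k+1) log²(k+4))`. -/
def wtSum (n : ℕ) : ℝ := ∑ k ∈ range n, 1 / wt k

/-- The rate `C^γ_N = ∑_{k=0}^{N-1} γ_{k+1}² Π_{1,N} / Π_{1,k}`. -/
def rateC (N : ℕ) : ℝ := ∑ k ∈ range N, D.γ (k + 1) ^ 2 * (D.Pi1 N / D.Pi1 k)

/-- The rate `C^{γ,α}_N = ∑_{k=0}^{N-1} γ_{k+1}^{2α/(2α-1)} (Π_{1,N} / Π_{1,k})^{α/(2α-1)}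
((k+1) log²(k+4))^{(1-α)/(2α-1)}`. -/
def rateCα (N : ℕ) : ℝ :=
  ∑ k ∈ range N, D.γ (k + 1) ^ (2 * D.α / (2 * D.α - 1)) *
    (D.Pi1 N / D.Pi1 k) ^ (D.α / (2 * D.α - 1)) *
    wt k ^ ((1 - D.α) / (2 * D.α - 1))

/-- `s̃_N = max_{0 ≤ k ≤ N-1} (k+1)^{1/2} log(k+4) γ_{k+1} (Π_{1,N} / Π_{1,k})^{1/2} exp(S_N)`. -/
def sTilde (N : ℕ) : ℝ :=
  ⨆ k : Fin N, Real.sqrt ((k : ℝ) + 1) * Real.log ((k : ℝ) + 4) * D.γ (k + 1) *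
    Real.sqrt (D.Pi1 N / D.Pi1 k) * Real.exp (wtSum N)

/-! ### The explicit constants -/

/-- `Γ_N = ∑_{k=0}^{N-1} γ_{k+1}²`. -/
def Gam2 (N : ℕ) : ℝ := ∑ k ∈ range N, D.γ (k + 1) ^ 2

/-- `G_N = max(1, γ_1², …, γ_N²)`. -/
def stepMax (N : ℕ) : ℝ := max 1 (⨆ k : Fin N, D.γ (k + 1) ^ 2)

/-- `Π_{2,N} = ∏_{k=0}^{N-1} (1 + (2 η α C_h + (β/2) α² C_L C_α²) γ_{k+1}²)`. -/
def Pi2 (N : ℕ) : ℝ :=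
  ∏ k ∈ range N, (1 + (2 * D.η * D.α * D.Ch + D.β / 2 * D.α ^ 2 * D.CL * D.Cα ^ 2) *
    D.γ (k + 1) ^ 2)

/-- `C̲ = 4 η α C_α² E[|U|²]`. -/
def Cbar : ℝ := 4 * D.η * D.α * D.Cα ^ 2 * D.m2

/-- `ε_β = 1 / (2 β)`; under `GC(β)` the variable `exp(ε_β |U|²)` is integrable. -/
def epsβ : ℝ := 1 / (2 * D.β)

/-- `log E[exp(s |U|²)]`. -/
def logMom (s : ℝ) : ℝ := Real.log (∫ u, Real.exp (s * ‖u‖ ^ 2) ∂D.μ)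

/-- `Λ_N = min(1, ε_β / (8 η α C_α² G_N)) / Π_{2,N}`. -/
def LamN (N : ℕ) : ℝ :=
  min 1 (D.epsβ / (8 * D.η * D.α * D.Cα ^ 2 * D.stepMax N)) / D.Pi2 N

/-- `ρ̄_N = Λ_N / 2`. -/
def rhoBar (N : ℕ) : ℝ := D.LamN N / 2

/-- The exponent `Ψ` in the constant `K = exp(Ψ)`, for `α ∈ (1/2, 1]`. -/
def PsiN (N : ℕ) : ℝ :=
  (2 * D.α - 1) / D.α * D.rhoBar N ^ (-((1 - D.α) / (2 * D.α - 1))) +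
  (D.L D.θ₀ ^ D.α + D.Cbar * D.Gam2 N) * D.Pi2 N * D.rhoBar N * ((1 - D.α) / D.α) +
  1 / 2 * D.Gam2 N * D.logMom (D.epsβ * (1 - D.α) / (2 * D.α))

/-- The constant `φ_α(γ, H, θ₀)` for `α ∈ (1/2, 1]`. -/
def phiConst (N : ℕ) : ℝ :=
  Real.exp (D.PsiN N) * (2 : ℝ) ^ (2 * D.α / (2 * D.α - 1)) *
    max (D.β * D.Cα ^ 2 / 4) ((D.β * D.Cα ^ 2 / 4) ^ (D.α / (2 * D.α - 1))) *
    Real.exp (1 / (2 * D.α - 1) * wtSum N)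

/-- The constant `λ_*` for `α = 1/2`. -/
def lamStar (N : ℕ) : ℝ := Real.sqrt (D.LamN N / (D.β * D.Cα ^ 2))

/-- The constant `φ_{1/2}(γ, H, θ₀)`. -/
def phiConstHalf (N : ℕ) : ℝ :=
  1 / 4 * Real.exp (wtSum N) *
    (D.LamN N * D.Pi2 N * (D.L D.θ₀ ^ (1 / 2 : ℝ) + D.Cbar * D.Gam2 N) +
      1 / 2 * D.Gam2 N * D.logMom D.epsβ)

/-! ### The functions `Φ_{α,N}` -/

/-- `Φ_{α,N}(ρ) = φ_α (C^γ_N ρ² ∨ C^{γ,α}_N ρ^{2α/(2α-1)})`, for `α ∈ (1/2, 1]`. -/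
def Phi (N : ℕ) (ρ : ℝ≥0) : EReal :=
  ((D.phiConst N *
    max (D.rateC N * (ρ : ℝ) ^ 2) (D.rateCα N * (ρ : ℝ) ^ (2 * D.α / (2 * D.α - 1))) : ℝ) : EReal)

open scoped Classical in
/-- `Φ_{1/2,N}(ρ) = 2 φ_{1/2} C^γ_N (ρ/λ_*)² / (1 - ρ s̃_N / λ_*)` for
`0 ≤ ρ < λ_* / s̃_N`, that is, for `ρ s̃_N < λ_*`, and `+∞` otherwise. -/
def PhiHalf (N : ℕ) (ρ : ℝ≥0) : EReal :=
  if (ρ : ℝ) * D.sTilde N < D.lamStar N then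
    ((2 * D.phiConstHalf N * D.rateC N *
      (((ρ : ℝ) / D.lamStar N) ^ 2 / (1 - (ρ : ℝ) * D.sTilde N / D.lamStar N)) : ℝ) : EReal)
  else ⊤

end RMData

end

/-! The inequality is dual to a bound on Laplace transforms. If `E exp(ρ f(θ_N)) ≤ exp(ρ E f(θ_N) +
Φ(ρ))` for all bounded 1-Lipschitz `f`, then Donsker–Varadhan gives `ρ (∫ f dν - ∫ f dμ_N) ≤ H(ν,
μ_N) + Φ(ρ)`, and Kantorovich duality turns the supremum over `f` into `W₁`
(`satisfiesTransportEntropy_of_laplace`). Duality itself comes from Hahn–Banach on finitely many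
points, followed by an approximation by simple functions.

The Laplace bound is a backward recursion (`expBound_law_of_lipschitz`). Given `θ_n`, the map `u ↦
f(θ_n - γ H(θ_n, u))` is Lipschitz with constant of order `γ C_α L(θ_n)^((1-α)/2)`, so `GC(β)`
replaces `f` by its conditional expectation at a cost of order `ρ² γ² L(θ_n)^(1-α)`. The conditional
expectation is again Lipschitz, its constant being multiplied by `√(1 - 2λγ + C_{H,μ} γ²)` by strong
monotonicity of `h` and (HL). The cost is random; Hölder's inequality with exponents `1 + 1/w_n` and
`1 + w_n`, `w_n = (n+1) log²(n+4)`, separates it from the conditional expectation. As `∑ 1/w_n`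
converges, the accumulated exponents stay below `exp(S_N)`.

What remains is to bound exponential moments of `L^(1-α)` along the scheme. A Taylor expansion of
`L`, concavity of `x ↦ x^α` and `GC(β)` control `E exp(ρ L(θ_n)^α)` for `ρ ≤ Λ_N`
(`expBound_law_L`). If `α > 1/2`, then `1 - α < α`, and Young's inequality allows any coefficient in
front of `L^(1-α)` (`expBound_law_rpow`). If `α = 1/2` the two powers agree, so the coefficient must
not exceed `Λ_N`; this is ensured by `ρ s̃_N < λ_*` (`weight_le_LamN`). -/

/-! ### Entropy duality and finite Kantorovich duality. -/

/-- The Donsker–Varadhan inequality for bounded functions. -/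
theorem integral_le_klDiv_add_log {E : Type*} [MeasurableSpace E] {ν μ : Measure E}
    [IsProbabilityMeasure ν] [IsProbabilityMeasure μ] (hkl : InformationTheory.klDiv ν μ ≠ ∞)
    {g : E → ℝ} (hg : Measurable g) {C : ℝ} (hC : ∀ x, |g x| ≤ C) :
    ∫ x, g x ∂ν ≤
      (InformationTheory.klDiv ν μ).toReal + Real.log (∫ x, Real.exp (g x) ∂μ) := by
  obtain ⟨hac, hint⟩ := InformationTheory.klDiv_ne_top_iff.1 hkl
  have hgν : Integrable g ν := Integrable.of_bound hg.aestronglyMeasurable C (.of_forall hC)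
  have hexp : Integrable (fun x => Real.exp (g x)) μ :=
    Integrable.of_bound hg.exp.aestronglyMeasurable (Real.exp C)
      (.of_forall fun x => by simpa using (abs_le.1 (hC x)).2)
  have := isProbabilityMeasure_tilted hexp
  have h1 := integral_llr_tilted_right hac hgν hexp hint
  have h2 := InformationTheory.integral_llr_add_sub_measure_univ_nonneg
    (hac.trans (absolutelyContinuous_tilted hexp)) (integrable_llr_tilted_right hac hgν hint hexp)
  rw [InformationTheory.toReal_klDiv_of_measure_eq hac (by simp)]
  simp at h2
  linarith

/-- Kantorovich duality for two probability vectors, indexed by finitely many points. -/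
theorem exists_coupling_of_forall_lipschitz {S E : Type*} [Fintype S] [PseudoMetricSpace E]
    (x : S → E) {a b : S → ℝ} (ha : a ∈ stdSimplex ℝ S) (hb : b ∈ stdSimplex ℝ S) {B : ℝ}
    (hB : ∀ f : E → ℝ, LipschitzWith 1 f → (∃ C, ∀ y, |f y| ≤ C) →
      ∑ i, a i * f (x i) - ∑ i, b i * f (x i) < B) :
    ∃ π : S → S → ℝ, (∀ i j, 0 ≤ π i j) ∧ (∀ i, ∑ j, π i j = a i) ∧ (∀ j, ∑ i, π i j = b j) ∧
      ∑ i, ∑ j, π i j * dist (x i) (x j) ≤ B := by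
  classical
  by_contra hcon
  push Not at hcon
  -- `T` sends a weight on pairs to its two marginals and its cost. If no coupling costs at most
  -- `B`, the compact image of the simplex misses `{a} × {b} × (-∞, B]`, and a linear functional
  -- `(φ, ψ, τ)` separates them strictly.
  let v : S × S → (S → ℝ) × (S → ℝ) × ℝ := fun p =>
    (Pi.single p.1 1, Pi.single p.2 1, dist (x p.1) (x p.2))
  let T := Fintype.linearCombination ℝ v
  have hT : ∀ w, T w = (fun i => ∑ j, w (i, j), fun j => ∑ i, w (i, j),
      ∑ i, ∑ j, w (i, j) * dist (x i) (x j)) := by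
    intro w
    simp only [T, Fintype.linearCombination_apply, v]
    refine Prod.ext ?_ (Prod.ext ?_ ?_)
    · ext i
      simp [Prod.fst_sum, Fintype.sum_prod_type, Pi.single_apply]
    · ext i
      simp [Prod.fst_sum, Prod.snd_sum, Fintype.sum_prod_type, Pi.single_apply]
    · simp [Prod.snd_sum, Fintype.sum_prod_type]
  have hcomp : IsCompact (T '' stdSimplex ℝ (S × S)) :=
    (isCompact_stdSimplex ℝ (S × S)).image T.continuous_of_finiteDimensional
  have hconv : Convex ℝ (T '' stdSimplex ℝ (S × S)) :=
    (convex_stdSimplex ℝ (S × S)).linear_image T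
  have hdisj : Disjoint (T '' stdSimplex ℝ (S × S)) ({a} ×ˢ ({b} ×ˢ Set.Iic B)) := by
    rw [Set.disjoint_left]
    rintro _ ⟨w, hw, rfl⟩ hm
    rw [hT] at hm
    simp only [Set.mem_prod, Set.mem_singleton_iff, Set.mem_Iic] at hm
    exact absurd hm.2.2 (not_le.2 (hcon (fun i j => w (i, j)) (fun i j => hw.1 _)
      (fun i => congrFun hm.1 i) (fun j => congrFun hm.2.1 j)))
  obtain ⟨g, r, s, hg1, hrs, hg2⟩ := geometric_hahn_banach_compact_closed hconv hcomp
    ((convex_singleton a).prod ((convex_singleton b).prod (convex_Iic B)))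
    (isClosed_singleton.prod (isClosed_singleton.prod isClosed_Iic)) hdisj
  let φ : S → ℝ := fun i => g (Pi.single i 1, 0, 0)
  let ψ : S → ℝ := fun i => g (0, Pi.single i 1, 0)
  let τ : ℝ := g (0, 0, 1)
  have hgv : ∀ (p q : S → ℝ) (t : ℝ), g (p, q, t) = ∑ i, p i * φ i + ∑ i, q i * ψ i + t * τ := by
    intro p q t
    have e : (p, q, t) = ∑ i, p i • ((Pi.single i 1, 0, 0) : (S → ℝ) × (S → ℝ) × ℝ) +
        ∑ i, q i • ((0, Pi.single i 1, 0) : (S → ℝ) × (S → ℝ) × ℝ) + t • (0, 0, 1) := by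
      refine Prod.ext ?_ (Prod.ext ?_ ?_)
      · ext i; simp [Prod.fst_sum, Pi.single_apply]
      · ext i; simp [Prod.fst_sum, Prod.snd_sum, Pi.single_apply]
      · simp [Prod.snd_sum]
    rw [e, map_add, map_add, map_sum, map_sum, map_smul]
    simp only [map_smul, smul_eq_mul, φ, ψ, τ]
  have hlow : ∀ t ≤ B, s < ∑ i, a i * φ i + ∑ i, b i * ψ i + t * τ := fun t ht => by
    rw [← hgv]; exact hg2 _ (by simpa using ht)
  have hup : ∀ w ∈ stdSimplex ℝ (S × S), g (T w) < r := fun w hw => hg1 _ ⟨w, hw, rfl⟩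
  have hab : (fun p : S × S => a p.1 * b p.2) ∈ stdSimplex ℝ (S × S) := by
    refine ⟨fun p => mul_nonneg (ha.1 _) (hb.1 _), ?_⟩
    rw [Fintype.sum_prod_type]
    simp [← Finset.mul_sum, ha.2, hb.2]
  -- The product coupling has marginals `a` and `b`; for `τ ≥ 0` it would lie on the wrong side of
  -- the separation.
  have hτ : τ < 0 := by
    by_contra hτ
    push Not at hτ
    have h1 := hup _ hab
    rw [hT, hgv] at h1
    simp only [← Finset.mul_sum, ← Finset.sum_mul, ha.2, hb.2, mul_one, one_mul] at h1
    have h2 := hlow (min B (∑ i, ∑ j, a i * b j * dist (x i) (x j))) (min_le_left _ _)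
    have h3 := mul_le_mul_of_nonneg_right
      (min_le_right B (∑ i, ∑ j, a i * b j * dist (x i) (x j))) hτ
    linarith
  set m := ∑ i, a i * φ i + ∑ i, b i * ψ i + B * τ
  have hpt : ∀ i j, φ i + ψ j + dist (x i) (x j) * τ < m := by
    intro i j
    have h1 := hup _ (single_mem_stdSimplex ℝ (i, j))
    have h2 := hlow B le_rfl
    have h3 : T (Pi.single (i, j) 1) = v (i, j) := by
      simp [T, Fintype.linearCombination_apply_single]
    rw [h3, hgv] at h1
    simp [Pi.single_apply] at h1
    linarith
  have hne : Nonempty S := by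
    by_contra h
    rw [not_nonempty_iff] at h
    have := ha.2
    simp at this
  -- The point masses give `φ i + ψ j + τ d(x i, x j) < m`. Dividing by `τ < 0`, this infimal
  -- convolution lies above `(m - φ i) / τ` and below `ψ i / τ` at `x i`, so it is a Lipschitz test
  -- function whose gap is at least `B`.
  let F : E → ℝ := fun y => univ.inf' univ_nonempty fun j => dist y (x j) + ψ j / τ
  have hF : LipschitzWith 1 F := by
    refine LipschitzWith.of_le_add fun y z => ?_
    obtain ⟨j, -, hj⟩ := exists_mem_eq_inf' univ_nonempty fun j => dist z (x j) + ψ j / τ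
    have h1 : F y ≤ dist y (x j) + ψ j / τ := inf'_le _ (mem_univ j)
    have h2 : F z = dist z (x j) + ψ j / τ := hj
    linarith [dist_triangle y z (x j)]
  have hF1 : ∀ i, (m - φ i) / τ ≤ F (x i) := by
    intro i
    refine le_inf' _ _ fun j _ => ?_
    rw [div_le_iff_of_neg hτ, add_mul, div_mul_cancel₀ _ hτ.ne]
    linarith [hpt i j]
  have hF2 : ∀ j, F (x j) ≤ ψ j / τ := fun j =>
    (inf'_le _ (mem_univ j)).trans (by simp)
  -- Truncation at a level not reached at the points `x i` makes the test function bounded without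
  -- changing these values.
  let C := ∑ i, |F (x i)|
  have hC0 : 0 ≤ C := sum_nonneg fun _ _ => abs_nonneg _
  let f : E → ℝ := fun y => max (-C) (min C (F y))
  have hf : LipschitzWith 1 f := (hF.const_min C).const_max (-C)
  have hfx : ∀ i, f (x i) = F (x i) := by
    intro i
    have h1 : |F (x i)| ≤ C :=
      single_le_sum (f := fun i => |F (x i)|) (fun _ _ => abs_nonneg _) (mem_univ i)
    simp [f, min_eq_right (abs_le.1 h1).2, (abs_le.1 h1).1]
  have hfB := hB f hf ⟨C, fun y => abs_le.2
    ⟨le_max_left _ _, max_le (by linarith) (min_le_left _ _)⟩⟩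
  simp only [hfx] at hfB
  have h1 : ∑ i, a i * ((m - φ i) / τ) ≤ ∑ i, a i * F (x i) :=
    sum_le_sum fun i _ => mul_le_mul_of_nonneg_left (hF1 i) (ha.1 i)
  have h2 : ∑ i, b i * F (x i) ≤ ∑ i, b i * (ψ i / τ) :=
    sum_le_sum fun i _ => mul_le_mul_of_nonneg_left (hF2 i) (hb.1 i)
  have h3 : ∑ i, a i * ((m - φ i) / τ) = (m - ∑ i, a i * φ i) / τ := by
    simp only [← mul_div_assoc, ← sum_div, mul_sub, sum_sub_distrib, ← sum_mul, ha.2, one_mul]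
  have h4 : ∑ i, b i * (ψ i / τ) = (∑ i, b i * ψ i) / τ := by
    simp only [← mul_div_assoc, ← sum_div]
  have h5 : (m - ∑ i, a i * φ i) / τ - (∑ i, b i * ψ i) / τ = B := by
    rw [← sub_div, div_eq_iff hτ.ne]; simp only [m]; ring
  linarith

/-- A coupling of the images of `ν` and `μ` under a map to a finite type lifts to a coupling of
`ν` and `μ`. -/
theorem exists_lift_coupling {E S : Type*} [MeasurableSpace E] [Fintype S] [MeasurableSpace S]
    [MeasurableSingletonClass S] {ν μ : Measure E} [IsProbabilityMeasure ν]
    [IsProbabilityMeasure μ] {c : E → S} (hc : Measurable c) {w : S → S → ℝ}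
    (hw : ∀ i j, 0 ≤ w i j) (hw1 : ∀ i, ∑ j, w i j = (ν.map c).real {i})
    (hw2 : ∀ j, ∑ i, w i j = (μ.map c).real {j}) :
    ∃ π : Measure (E × E), π.map Prod.fst = ν ∧ π.map Prod.snd = μ ∧
      ∀ Q : S → S → ℝ≥0∞,
        ∫⁻ z, Q (c z.1) (c z.2) ∂π ≤ ∑ i, ∑ j, ENNReal.ofReal (w i j) * Q i j := by
  have hpν : IsProbabilityMeasure (ν.map c) := Measure.isProbabilityMeasure_map hc.aemeasurable
  have hpμ : IsProbabilityMeasure (μ.map c) := Measure.isProbabilityMeasure_map hc.aemeasurable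
  set a := fun i => (ν.map c).real {i} with ha
  set b := fun i => (μ.map c).real {i} with hb
  have ha' : ∀ i, (ν.map c) {i} = ENNReal.ofReal (a i) := fun i => (ofReal_measureReal).symm
  have hb' : ∀ i, (μ.map c) {i} = ENNReal.ofReal (b i) := fun i => (ofReal_measureReal).symm
  have ha0 : ∀ i, 0 ≤ a i := fun i => measureReal_nonneg
  have hb0 : ∀ i, 0 ≤ b i := fun i => measureReal_nonneg
  -- The density of the lifted coupling with respect to `ν ⊗ μ`: on the cell `(i, j)` the mass `w i
  -- j` is spread like the product measure. A zero denominator gives the value `0`, harmless because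
  -- `w i j` then vanishes too.
  let g : S → S → ℝ≥0∞ := fun i j => ENNReal.ofReal (w i j / (a i * b j))
  have hwa : ∀ i j, a i = 0 → w i j = 0 := fun i j h =>
    (sum_eq_zero_iff_of_nonneg fun j _ => hw i j).1 ((hw1 i).trans h) j (mem_univ _)
  have hwb : ∀ i j, b j = 0 → w i j = 0 := fun i j h =>
    (sum_eq_zero_iff_of_nonneg fun i _ => hw i j).1 ((hw2 j).trans h) i (mem_univ _)
  have hm2 : ∀ Q : S → S → ℝ≥0∞, Measurable fun z : E × E => Q (c z.1) (c z.2) := fun Q =>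
    (measurable_of_finite (Function.uncurry Q)).comp
      ((hc.comp measurable_fst).prodMk (hc.comp measurable_snd))
  have hG : Measurable fun z : E × E => g (c z.1) (c z.2) := hm2 g
  have inner1 : ∀ i, a i ≠ 0 → ∫⁻ z, g i (c z) ∂μ = 1 := by
    intro i hi
    rw [← lintegral_map (f := g i) (measurable_of_finite _) hc, lintegral_fintype]
    have : ∀ j, g i j * (μ.map c) {j} = ENNReal.ofReal (w i j / a i) := by
      intro j
      rw [hb', ← ENNReal.ofReal_mul (div_nonneg (hw i j) (mul_nonneg (ha0 i) (hb0 j)))]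
      congr 1
      rcases eq_or_ne (b j) 0 with h | h
      · simp [h, hwb i j h]
      · field_simp
    rw [sum_congr rfl fun j _ => this j,
      ← ENNReal.ofReal_sum_of_nonneg fun j _ => div_nonneg (hw i j) (ha0 i), ← sum_div, hw1,
      div_self hi, ENNReal.ofReal_one]
  have inner2 : ∀ j, b j ≠ 0 → ∫⁻ y, g (c y) j ∂ν = 1 := by
    intro j hj
    rw [← lintegral_map (f := fun i => g i j) (measurable_of_finite _) hc, lintegral_fintype]
    have : ∀ i, g i j * (ν.map c) {i} = ENNReal.ofReal (w i j / b j) := by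
      intro i
      rw [ha', ← ENNReal.ofReal_mul (div_nonneg (hw i j) (mul_nonneg (ha0 i) (hb0 j)))]
      congr 1
      rcases eq_or_ne (a i) 0 with h | h
      · simp [h, hwa i j h]
      · field_simp
    rw [sum_congr rfl fun i _ => this i,
      ← ENNReal.ofReal_sum_of_nonneg fun i _ => div_nonneg (hw i j) (hb0 j), ← sum_div, hw2,
      div_self hj, ENNReal.ofReal_one]
  have aeν : ∀ᵐ y ∂ν, a (c y) ≠ 0 := by
    refine ae_of_ae_map hc.aemeasurable (p := fun i => a i ≠ 0) ?_
    rw [ae_iff_of_countable]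
    intro i hi h
    rw [ha', h] at hi
    simp at hi
  have aeμ : ∀ᵐ y ∂μ, b (c y) ≠ 0 := by
    refine ae_of_ae_map hc.aemeasurable (p := fun i => b i ≠ 0) ?_
    rw [ae_iff_of_countable]
    intro i hi h
    rw [hb', h] at hi
    simp at hi
  refine ⟨(ν.prod μ).withDensity fun z => g (c z.1) (c z.2), ?_, ?_, ?_⟩
  · refine Measure.ext_of_lintegral _ fun f hf => ?_
    have hf' : Measurable fun z : E × E => f z.1 := hf.comp measurable_fst
    rw [lintegral_map hf measurable_fst, lintegral_withDensity_eq_lintegral_mul _ hG hf',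
      lintegral_prod _ (hG.mul hf').aemeasurable]
    refine lintegral_congr_ae ?_
    filter_upwards [aeν] with y hy
    simp only [Pi.mul_apply]
    have hm : Measurable fun z => g (c y) (c z) := (measurable_of_finite (g (c y))).comp hc
    rw [lintegral_mul_const _ hm, inner1 _ hy, one_mul]
  · refine Measure.ext_of_lintegral _ fun f hf => ?_
    have hf' : Measurable fun z : E × E => f z.2 := hf.comp measurable_snd
    rw [lintegral_map hf measurable_snd, lintegral_withDensity_eq_lintegral_mul _ hG hf',
      lintegral_prod_symm _ (hG.mul hf').aemeasurable]
    refine lintegral_congr_ae ?_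
    filter_upwards [aeμ] with y hy
    simp only [Pi.mul_apply]
    have hm : Measurable fun x => g (c x) (c y) :=
      (measurable_of_finite fun i => g i (c y)).comp hc
    rw [lintegral_mul_const _ hm, inner2 _ hy, one_mul]
  · intro Q
    rw [lintegral_withDensity_eq_lintegral_mul _ hG (hm2 Q),
      lintegral_prod _ (hG.mul (hm2 Q)).aemeasurable]
    simp only [Pi.mul_apply]
    have e1 : ∀ i, ∫⁻ z, g i (c z) * Q i (c z) ∂μ = ∑ j, g i j * Q i j * (μ.map c) {j} := by
      intro i
      rw [← lintegral_map (f := fun j => g i j * Q i j) (measurable_of_finite _) hc,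
        lintegral_fintype]
    simp only [e1]
    rw [← lintegral_map (f := fun i => ∑ j, g i j * Q i j * (μ.map c) {j})
      (measurable_of_finite _) hc, lintegral_fintype]
    refine sum_le_sum fun i _ => ?_
    rw [sum_mul]
    refine sum_le_sum fun j _ => ?_
    have hring : ∀ p q r s : ℝ≥0∞, p * q * r * s = p * (r * s) * q := fun p q r s => by ring
    rw [hb', ha', hring]
    gcongr
    rw [← ENNReal.ofReal_mul (hb0 j),
      ← ENNReal.ofReal_mul (div_nonneg (hw i j) (mul_nonneg (ha0 i) (hb0 j)))]
    refine ENNReal.ofReal_le_ofReal ?_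
    rw [mul_comm (b j)]
    rcases eq_or_ne (a i * b j) 0 with h | h
    · simpa [h] using hw i j
    · rw [div_mul_cancel₀ _ h]

/-! ### Kantorovich duality for `W₁` on a normed group. -/

section Kantorovich

variable {E : Type*} [NormedAddCommGroup E] [MeasurableSpace E] [BorelSpace E]

/-- The truncated norms `min ‖x‖ n` are admissible test functions with a uniform bound, and monotone
convergence finishes. This supplies the first moment of `ν` needed to approximate in `L¹`. -/
theorem integrable_norm_of_forall_lipschitz {ν μ : Measure E} [IsProbabilityMeasure ν]
    [IsProbabilityMeasure μ] (hμ : Integrable (fun x => ‖x‖) μ) {B : ℝ}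
    (hB : ∀ f : E → ℝ, LipschitzWith 1 f → (∃ C, ∀ y, |f y| ≤ C) →
      ∫ x, f x ∂ν - ∫ x, f x ∂μ ≤ B) :
    Integrable (fun x => ‖x‖) ν := by
  refine ⟨measurable_norm.aestronglyMeasurable, ?_⟩
  have hlip : ∀ n : ℕ, LipschitzWith 1 fun x : E => min ‖x‖ n :=
    fun n => lipschitzWith_one_norm.min_const _
  have h0 : ∀ (n : ℕ) (x : E), 0 ≤ min ‖x‖ (n : ℝ) := fun n x => by positivity
  have hbd : ∀ (n : ℕ) (x : E), |min ‖x‖ (n : ℝ)| ≤ n := fun n x => by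
    rw [abs_of_nonneg (h0 n x)]; exact min_le_right _ _
  have hint : ∀ (n : ℕ) (ρ : Measure E) [IsProbabilityMeasure ρ],
      Integrable (fun x : E => min ‖x‖ (n : ℝ)) ρ := fun n ρ _ =>
    Integrable.of_bound (hlip n).continuous.measurable.aestronglyMeasurable n
      (.of_forall (hbd n))
  have key : ∀ n : ℕ, ∫⁻ x, ENNReal.ofReal (min ‖x‖ n) ∂ν ≤
      ENNReal.ofReal (B + ∫ x, ‖x‖ ∂μ) := by
    intro n
    rw [← ofReal_integral_eq_lintegral_ofReal (hint n ν) (.of_forall (h0 n))]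
    refine ENNReal.ofReal_le_ofReal ?_
    have h1 := hB _ (hlip n) ⟨n, hbd n⟩
    have h2 : ∫ x, min ‖x‖ (n : ℝ) ∂μ ≤ ∫ x, ‖x‖ ∂μ :=
      integral_mono (hint n μ) hμ fun x => min_le_left _ _
    linarith
  have hsup : ∀ x : E, ‖‖x‖‖ₑ = ⨆ n : ℕ, ENNReal.ofReal (min ‖x‖ n) := by
    intro x
    rw [enorm_norm, ← ofReal_norm]
    refine le_antisymm ?_ (iSup_le fun n => ENNReal.ofReal_le_ofReal (min_le_left _ _))
    obtain ⟨n, hn⟩ := exists_nat_ge ‖x‖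
    exact le_iSup_of_le n (by rw [min_eq_left hn])
  rw [HasFiniteIntegral, lintegral_congr hsup, lintegral_iSup]
  · exact (iSup_le key).trans_lt ENNReal.ofReal_lt_top
  · exact fun n => (hlip n).continuous.measurable.ennreal_ofReal
  · intro m n hmn x
    exact ENNReal.ofReal_le_ofReal (min_le_min_left _ (by exact_mod_cast hmn))

/-- The Kantorovich–Rubinstein bound: the Wasserstein distance is controlled by bounded Lipschitz
test functions. -/
theorem wasserstein1_le_of_forall_lipschitz [SecondCountableTopology E] {ν μ : Measure E}
    [IsProbabilityMeasure ν] [IsProbabilityMeasure μ] (hμ : Integrable (fun x => ‖x‖) μ) {B : ℝ}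
    (hB : ∀ f : E → ℝ, LipschitzWith 1 f → (∃ C, ∀ y, |f y| ≤ C) →
      ∫ x, f x ∂ν - ∫ x, f x ∂μ ≤ B) :
    wasserstein1 ν μ ≤ ENNReal.ofReal B := by
  have hν := integrable_norm_of_forall_lipschitz hμ hB
  have hB0 : 0 ≤ B := by
    simpa using hB (fun _ => 0) (LipschitzWith.const' 0) ⟨0, by simp⟩
  refine ENNReal.le_of_forall_pos_le_add fun ε hε _ => ?_
  -- Working under `ν + μ` yields one simple function close to the identity for both measures at
  -- once.
  have hid : Integrable (fun x : E => x) (ν + μ) := by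
    refine (integrable_norm_iff measurable_id.aestronglyMeasurable).1 ?_
    exact Integrable.add_measure hν hμ
  have htend := SimpleFunc.tendsto_approxOn_range_L1_enorm (measurable_id (α := E)) hid
  have hδ : (0 : ℝ≥0∞) < (ε / 8 : ℝ≥0) := by exact_mod_cast (by positivity : 0 < ε / 8)
  obtain ⟨n, hn⟩ := ((tendsto_order.1 htend).2 _ hδ).exists
  set s := SimpleFunc.approxOn (id : E → E) measurable_id (Set.range id ∪ {0}) 0 (by simp) n
  let c : E → s.range := fun y => ⟨s y, s.mem_range_self y⟩
  have hc : Measurable c := s.measurable.subtype_mk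
  have herr : ∀ ρ : Measure E, ρ ≤ ν + μ →
      ∫⁻ y, edist (s y) y ∂ρ ≤ (ε / 8 : ℝ≥0) := by
    intro ρ hρ
    refine (lintegral_mono' hρ le_rfl).trans ?_
    simp only [edist_eq_enorm_sub]
    exact hn.le
  have hpν : IsProbabilityMeasure (ν.map c) := Measure.isProbabilityMeasure_map hc.aemeasurable
  have hpμ : IsProbabilityMeasure (μ.map c) := Measure.isProbabilityMeasure_map hc.aemeasurable
  have hsimp : ∀ (ρ : Measure s.range) [IsProbabilityMeasure ρ],
      (fun i => ρ.real {i}) ∈ stdSimplex ℝ s.range := fun ρ _ =>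
    ⟨fun i => measureReal_nonneg, by simp⟩
  have hdiff : ∀ (ρ : Measure E) [IsProbabilityMeasure ρ], ρ ≤ ν + μ → ∀ f : E → ℝ,
      LipschitzWith 1 f → (∃ C, ∀ y, |f y| ≤ C) →
      |∑ i, (ρ.map c).real {i} * f i - ∫ y, f y ∂ρ| ≤ ε / 8 := by
    intro ρ _ hρ f hf ⟨C, hC⟩
    have : IsProbabilityMeasure (ρ.map c) := Measure.isProbabilityMeasure_map hc.aemeasurable
    have e1 : ∑ i, (ρ.map c).real {i} * f i = ∫ y, f (s y) ∂ρ := by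
      have := integral_map (μ := ρ) hc.aemeasurable
        (f := fun i : s.range => f i) (measurable_of_finite _).aestronglyMeasurable
      rw [← this, integral_fintype .of_finite]
      simp
    rw [e1, ← integral_sub]
    · have h1 := enorm_integral_le_lintegral_enorm (μ := ρ) fun y => f (s y) - f y
      have h2 : ∫⁻ y, ‖f (s y) - f y‖ₑ ∂ρ ≤ (ε / 8 : ℝ≥0) := by
        refine (lintegral_mono fun y => ?_).trans (herr ρ hρ)
        rw [← edist_eq_enorm_sub]
        simpa using hf (s y) y
      have h3 := h1.trans h2
      rw [← ofReal_norm, Real.norm_eq_abs] at h3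
      have h4 := (ENNReal.ofReal_le_iff_le_toReal ENNReal.coe_ne_top).1 h3
      simpa using h4
    · exact Integrable.of_bound (hf.continuous.measurable.comp s.measurable).aestronglyMeasurable C
        (.of_forall fun y => hC _)
    · exact Integrable.of_bound hf.continuous.measurable.aestronglyMeasurable C
        (.of_forall fun y => hC _)
  -- The discretisation errors of `ν` and `μ` make up `ε / 4`; the further `ε / 8` makes the
  -- required inequality strict.
  obtain ⟨w, hw0, hw1, hw2, hw3⟩ := exists_coupling_of_forall_lipschitz
    (fun i : s.range => (i : E)) (hsimp (ν.map c)) (hsimp (μ.map c)) (B := B + ε / 4 + ε / 8)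
    (fun f hf hb => by
      have h1 := abs_le.1 (hdiff ν (Measure.le_add_right le_rfl) f hf hb)
      have h2 := abs_le.1 (hdiff μ (Measure.le_add_left le_rfl) f hf hb)
      have h3 := hB f hf hb
      have : (0 : ℝ) < ε := hε
      linarith [h1.2, h2.1])
  obtain ⟨π, hπ1, hπ2, hπ3⟩ := exists_lift_coupling hc hw0 hw1 hw2
  refine (iInf₂_le π ⟨hπ1, hπ2⟩).trans ?_
  have hms : Measurable fun y => edist (s y) y := by fun_prop
  have hmid : ∫⁻ z, edist (s z.1) (s z.2) ∂π ≤ ENNReal.ofReal (B + ε / 4 + ε / 8) := by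
    refine (hπ3 fun i j => edist (i : E) j).trans ?_
    refine le_trans (le_of_eq ?_) (ENNReal.ofReal_le_ofReal hw3)
    have hnn : ∀ i j, 0 ≤ w i j * dist (i : E) j := fun i j => mul_nonneg (hw0 i j) dist_nonneg
    rw [ENNReal.ofReal_sum_of_nonneg fun i _ => sum_nonneg fun j _ => hnn i j]
    refine sum_congr rfl fun i _ => ?_
    rw [ENNReal.ofReal_sum_of_nonneg fun j _ => hnn i j]
    refine sum_congr rfl fun j _ => ?_
    rw [ENNReal.ofReal_mul (hw0 i j), edist_dist]
  have hfst : ∫⁻ z, edist (s z.1) z.1 ∂π ≤ (ε / 8 : ℝ≥0) := by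
    have := lintegral_map (μ := π) hms measurable_fst
    rw [← this, hπ1]
    exact herr ν (Measure.le_add_right le_rfl)
  have hsnd : ∫⁻ z, edist (s z.2) z.2 ∂π ≤ (ε / 8 : ℝ≥0) := by
    have := lintegral_map (μ := π) hms measurable_snd
    rw [← this, hπ2]
    exact herr μ (Measure.le_add_left le_rfl)
  calc ∫⁻ z, edist z.1 z.2 ∂π
      ≤ ∫⁻ z, (edist (s z.1) z.1 + edist (s z.1) (s z.2) + edist (s z.2) z.2) ∂π := by
        refine lintegral_mono fun z => ?_
        refine (edist_triangle4 z.1 (s z.1) (s z.2) z.2).trans (le_of_eq ?_)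
        rw [edist_comm z.1]
    _ = ∫⁻ z, edist (s z.1) z.1 ∂π + ∫⁻ z, edist (s z.1) (s z.2) ∂π +
        ∫⁻ z, edist (s z.2) z.2 ∂π := by
        have h1 : Measurable fun z : E × E => edist (s z.1) z.1 := hms.comp measurable_fst
        have h2 : Measurable fun z : E × E => edist (s z.2) z.2 := hms.comp measurable_snd
        rw [lintegral_add_right _ h2, lintegral_add_left h1]
    _ ≤ (ε / 8 : ℝ≥0) + ENNReal.ofReal (B + ε / 4 + ε / 8) + (ε / 8 : ℝ≥0) := by gcongr
    _ = ENNReal.ofReal (B + 5 / 8 * ε) := by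
        rw [← ENNReal.ofReal_coe_nnreal, ← ENNReal.ofReal_add (by positivity) (by positivity),
          ← ENNReal.ofReal_add (by positivity) (by positivity)]
        congr 1
        push_cast
        ring
    _ ≤ ENNReal.ofReal B + ε := by
        rw [← ENNReal.ofReal_coe_nnreal, ← ENNReal.ofReal_add hB0 NNReal.zero_le_coe]
        exact ENNReal.ofReal_le_ofReal (by linarith [ε.2, show (0 : ℝ) ≤ ε from ε.2])

end Kantorovich

/-! ### From Laplace transforms to transport-entropy inequalities. -/

/-- The Bobkov–Götze criterion: a bound of the Laplace transforms of Lipschitz functions implies a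
transport-entropy inequality. -/
theorem satisfiesTransportEntropy_of_laplace {E : Type*} [NormedAddCommGroup E]
    [MeasurableSpace E] [BorelSpace E] [SecondCountableTopology E] {μ : Measure E}
    [IsProbabilityMeasure μ] (hμ : Integrable (fun x => ‖x‖) μ) {Φ : ℝ≥0 → EReal} (h0 : 0 ≤ Φ 0)
    (hΦ : ∀ ρ : ℝ≥0, 0 < ρ → Φ ρ ≠ ⊤ → ∃ φ : ℝ, Φ ρ = φ ∧
      ∀ f : E → ℝ, LipschitzWith 1 f → (∃ C, ∀ y, |f y| ≤ C) →
        ∫ x, Real.exp (ρ * f x) ∂μ ≤ Real.exp (ρ * ∫ x, f x ∂μ + φ)) :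
    SatisfiesTransportEntropy (monotoneConj Φ) μ := by
  intro ν _
  by_cases hkl : InformationTheory.klDiv ν μ = ∞
  · simp [hkl]
  refine iSup_le fun ρ => ?_
  rcases eq_zero_or_pos ρ with rfl | hρ
  · have : (0 : EReal) - Φ 0 ≤ 0 := by
      simpa using EReal.sub_le_sub (le_refl (0 : EReal)) h0
    simpa using this.trans (EReal.coe_ennreal_nonneg _)
  by_cases htop : Φ ρ = ⊤
  · simp [htop]
  obtain ⟨φ, hφ, hlap⟩ := hΦ ρ hρ htop
  set k := (InformationTheory.klDiv ν μ).toReal with hk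
  have hρ' : (0 : ℝ) < ρ := hρ
  have hdv : ∀ f : E → ℝ, LipschitzWith 1 f → (∃ C, ∀ y, |f y| ≤ C) →
      ∫ x, f x ∂ν - ∫ x, f x ∂μ ≤ (k + φ) / ρ := by
    rintro f hf ⟨C, hC⟩
    have h1 := integral_le_klDiv_add_log hkl (g := fun x => (ρ : ℝ) * f x) (C := ρ * C)
      (by have := hf.continuous.measurable; fun_prop)
      (fun x => by rw [abs_mul, abs_of_pos hρ']; gcongr; exact hC x)
    have hpos : 0 < ∫ x, Real.exp (ρ * f x) ∂μ := by
      refine integral_exp_pos (Integrable.of_bound (C := Real.exp (ρ * C)) ?_ ?_)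
      · have := hf.continuous.measurable
        exact Measurable.aestronglyMeasurable (by fun_prop)
      · refine .of_forall fun x => ?_
        rw [Real.norm_eq_abs, Real.abs_exp]
        gcongr
        exact (abs_le.1 (hC x)).2
    have h2 := Real.log_le_log hpos (hlap f hf ⟨C, hC⟩)
    rw [Real.log_exp] at h2
    rw [integral_const_mul] at h1
    rw [le_div_iff₀ hρ']
    linarith
  -- The zero test function shows the sign, so that `ENNReal.ofReal (k + φ)` loses nothing.
  have hnn : 0 ≤ k + φ := by
    have := hdv (fun _ => 0) (LipschitzWith.const' 0) ⟨0, by simp⟩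
    simp only [integral_zero, sub_zero] at this
    rw [le_div_iff₀ hρ'] at this
    linarith
  have hW := wasserstein1_le_of_forall_lipschitz hμ hdv
  have h3 : wasserstein1 ν μ * (ρ : ℝ≥0∞) ≤ ENNReal.ofReal (k + φ) := by
    calc wasserstein1 ν μ * (ρ : ℝ≥0∞) ≤ ENNReal.ofReal ((k + φ) / ρ) * ENNReal.ofReal ρ := by
          rw [ENNReal.ofReal_coe_nnreal]; gcongr
      _ = ENNReal.ofReal (k + φ) := by
          rw [← ENNReal.ofReal_mul (by positivity), div_mul_cancel₀ _ hρ'.ne']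
  have h4 : ((wasserstein1 ν μ * (ρ : ℝ≥0∞) : ℝ≥0∞) : EReal) ≤ ((k + φ : ℝ) : EReal) := by
    refine (EReal.coe_ennreal_le_coe_ennreal_iff.2 h3).trans (le_of_eq ?_)
    rw [EReal.coe_ennreal_ofReal, max_eq_left hnn]
  rw [hφ]
  calc ((wasserstein1 ν μ * (ρ : ℝ≥0∞) : ℝ≥0∞) : EReal) - φ ≤ ((k + φ : ℝ) : EReal) - φ :=
        EReal.sub_le_sub h4 le_rfl
    _ = ((k : ℝ) : EReal) := by rw [← EReal.coe_sub]; congr 1; ring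
    _ = ((InformationTheory.klDiv ν μ : ℝ≥0∞) : EReal) := EReal.coe_ennreal_toReal hkl

/-! ### Consequences of Gaussian concentration. -/

namespace GaussianConcentration

variable {E : Type*} [NormedAddCommGroup E] [MeasurableSpace E] {β : ℝ} {μ : Measure E}

theorem integrable_norm (h : GaussianConcentration β μ) : Integrable (fun u => ‖u‖) μ :=
  (h _ lipschitzWith_one_norm).1

theorem of_lipschitz (h : GaussianConcentration β μ) [IsProbabilityMeasure μ] {g : E → ℝ} {K : ℝ}
    (hK : 0 ≤ K) (hg : ∀ u v, |g u - g v| ≤ K * ‖u - v‖) :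
    Integrable g μ ∧ ∀ s : ℝ, 0 ≤ s →
      Integrable (fun u => Real.exp (s * g u)) μ ∧
      ∫ u, Real.exp (s * g u) ∂μ ≤ Real.exp (s * ∫ u, g u ∂μ + β / 4 * s ^ 2 * K ^ 2) := by
  rcases hK.eq_or_lt with rfl | hK
  · have hc : g = fun _ => g 0 := by
      ext u
      have := hg u 0
      simpa [sub_eq_zero] using this
    rw [hc]
    exact ⟨integrable_const _, fun s hs => ⟨integrable_const _, by simp⟩⟩
  · have hL : LipschitzWith 1 fun u => g u / K := by
      refine LipschitzWith.of_dist_le_mul fun u v => ?_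
      rw [Real.dist_eq, ← sub_div, abs_div, abs_of_pos hK, div_le_iff₀ hK, dist_eq_norm]
      simpa [mul_comm] using hg u v
    obtain ⟨h1, h2⟩ := h _ hL
    refine ⟨?_, fun s hs => ?_⟩
    · have := h1.mul_const K
      simpa [hK.ne'] using this
    · obtain ⟨h3, h4⟩ := h2 (s * K) (by positivity)
      have e : ∀ u, s * K * (g u / K) = s * g u := fun u => by field_simp
      simp only [e] at h3 h4
      refine ⟨h3, h4.trans (le_of_eq ?_)⟩
      rw [integral_div]
      congr 1
      field_simp

/-- `exp((r‖u‖)²/2)` with `r² = 1/β` is a Gaussian average over `g` of `exp(g r ‖u‖)`. Exchanging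
the integrals, `GC(β)` costs only `g²/4` against the Gaussian weight `-g²/2`, so the integral over
`g` converges. As the concentration bound covers nonnegative parameters only, the average runs over
`g ≥ 0`. -/
theorem integrable_exp_norm_sq [BorelSpace E] (h : GaussianConcentration β μ)
    [IsProbabilityMeasure μ] (hβ : 0 < β) {s : ℝ} (hs : s ≤ 1 / (2 * β)) :
    Integrable (fun u => Real.exp (s * ‖u‖ ^ 2)) μ := by
  set r := 1 / Real.sqrt β with hr
  have hr0 : 0 < r := by positivity
  have hr2 : r ^ 2 = 1 / β := by rw [hr, div_pow, Real.sq_sqrt hβ.le, one_pow]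
  set m := ∫ u, ‖u‖ ∂μ with hm
  -- The window `[a, a + 1]` suffices: there `g a - g²/2 = a²/2 - (g - a)²/2 ≥ a²/2 - 1/2`.
  have low : ∀ a : ℝ, 0 ≤ a → ENNReal.ofReal (Real.exp (a ^ 2 / 2)) ≤
      ENNReal.ofReal (Real.exp (1 / 2)) *
        ∫⁻ g in Set.Ici (0 : ℝ), ENNReal.ofReal (Real.exp (g * a - g ^ 2 / 2)) := by
    intro a ha
    have h1 : ∫⁻ g in Set.Icc a (a + 1), ENNReal.ofReal (Real.exp (a ^ 2 / 2 - 1 / 2)) ≤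
        ∫⁻ g in Set.Ici (0 : ℝ), ENNReal.ofReal (Real.exp (g * a - g ^ 2 / 2)) := by
      refine (setLIntegral_mono' measurableSet_Icc fun g hg => ?_).trans
        (lintegral_mono_set fun g hg => ha.trans hg.1)
      refine ENNReal.ofReal_le_ofReal (Real.exp_le_exp.2 ?_)
      nlinarith [hg.1, hg.2]
    rw [setLIntegral_const, Real.volume_Icc] at h1
    refine le_trans (le_of_eq ?_) (mul_le_mul_right h1 _)
    rw [add_sub_cancel_left, ENNReal.ofReal_one, mul_one,
      ← ENNReal.ofReal_mul (Real.exp_pos _).le, ← Real.exp_add]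
    congr 2
    ring
  have hfin : ∫⁻ u, ENNReal.ofReal (Real.exp ((r * ‖u‖) ^ 2 / 2)) ∂μ < ∞ := by
    have hmeas : Measurable fun z : E × ℝ =>
        ENNReal.ofReal (Real.exp (z.2 * (r * ‖z.1‖) - z.2 ^ 2 / 2)) := by fun_prop
    calc ∫⁻ u, ENNReal.ofReal (Real.exp ((r * ‖u‖) ^ 2 / 2)) ∂μ
        ≤ ∫⁻ u, ENNReal.ofReal (Real.exp (1 / 2)) * (∫⁻ g in Set.Ici (0 : ℝ),
            ENNReal.ofReal (Real.exp (g * (r * ‖u‖) - g ^ 2 / 2))) ∂μ :=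
          lintegral_mono fun u => low _ (by positivity)
      _ = ENNReal.ofReal (Real.exp (1 / 2)) * ∫⁻ g in Set.Ici (0 : ℝ), ∫⁻ u,
            ENNReal.ofReal (Real.exp (g * (r * ‖u‖) - g ^ 2 / 2)) ∂μ := by
          rw [lintegral_const_mul' _ _ ENNReal.ofReal_ne_top,
            lintegral_lintegral_swap hmeas.aemeasurable]
      _ ≤ ENNReal.ofReal (Real.exp (1 / 2)) * ∫⁻ g in Set.Ici (0 : ℝ),
            ENNReal.ofReal (Real.exp (2 * (r * m) ^ 2) * Real.exp (-(1 / 8) * g ^ 2)) := by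
          refine mul_le_mul_right ?_ _
          refine setLIntegral_mono' measurableSet_Ici fun g hg => ?_
          have hg0 : 0 ≤ g := hg
          obtain ⟨i1, i2⟩ := (h _ lipschitzWith_one_norm).2 (g * r) (by positivity)
          have e : ∀ u : E, ENNReal.ofReal (Real.exp (g * (r * ‖u‖) - g ^ 2 / 2)) =
              ENNReal.ofReal (Real.exp (g * r * ‖u‖)) * ENNReal.ofReal (Real.exp (-g ^ 2 / 2)) := by
            intro u
            rw [← ENNReal.ofReal_mul (Real.exp_pos _).le, ← Real.exp_add]
            congr 2; ring
          simp only [e]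
          rw [lintegral_mul_const' _ _ ENNReal.ofReal_ne_top,
            ← ofReal_integral_eq_lintegral_ofReal i1 (.of_forall fun u => (Real.exp_pos _).le),
            ← ENNReal.ofReal_mul (integral_nonneg fun u => (Real.exp_pos _).le)]
          refine ENNReal.ofReal_le_ofReal ?_
          refine (mul_le_mul_of_nonneg_right i2 (Real.exp_pos _).le).trans ?_
          rw [← Real.exp_add, ← Real.exp_add, mul_pow g r, hr2, ← hm]
          refine Real.exp_le_exp.2 ?_
          have : β * (g ^ 2 * (1 / β)) / 4 = g ^ 2 / 4 := by field_simp
          rw [this]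
          nlinarith [sq_nonneg (g / 4 - r * m)]
      _ < ∞ := by
          have hi : Integrable fun g : ℝ =>
              Real.exp (2 * (r * m) ^ 2) * Real.exp (-(1 / 8) * g ^ 2) :=
            (integrable_exp_neg_mul_sq (by norm_num)).const_mul _
          refine ENNReal.mul_lt_top ENNReal.ofReal_lt_top ?_
          exact (setLIntegral_le_lintegral _ _).trans_lt hi.lintegral_lt_top
  have hmeas : ∀ t : ℝ, Measurable fun u : E => Real.exp (t * ‖u‖ ^ 2) := fun t => by fun_prop
  refine ⟨(hmeas s).aestronglyMeasurable, ?_⟩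
  rw [hasFiniteIntegral_iff_ofReal (.of_forall fun u => (Real.exp_pos _).le)]
  refine (lintegral_mono fun u => ENNReal.ofReal_le_ofReal (Real.exp_le_exp.2 ?_)).trans_lt hfin
  rw [mul_pow, hr2]
  calc s * ‖u‖ ^ 2 ≤ 1 / (2 * β) * ‖u‖ ^ 2 := by gcongr
    _ = 1 / β * ‖u‖ ^ 2 / 2 := by field_simp

theorem integrable_norm_sq [BorelSpace E] (h : GaussianConcentration β μ)
    [IsProbabilityMeasure μ] (hβ : 0 < β) : Integrable (fun u => ‖u‖ ^ 2) μ := by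
  have hs : 0 < 1 / (2 * β) := by positivity
  refine ((h.integrable_exp_norm_sq hβ le_rfl).const_mul (2 * β)).mono'
    (Measurable.aestronglyMeasurable (by fun_prop)) (.of_forall fun u => ?_)
  have h1 := Real.add_one_le_exp (1 / (2 * β) * ‖u‖ ^ 2)
  rw [Real.norm_eq_abs, abs_of_nonneg (by positivity)]
  calc ‖u‖ ^ 2 = 2 * β * (1 / (2 * β) * ‖u‖ ^ 2) := by field_simp
    _ ≤ 2 * β * Real.exp (1 / (2 * β) * ‖u‖ ^ 2) := by gcongr; linarith

end GaussianConcentration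

/-! ### Calculus and moment inequalities. -/

theorem image_add_le_of_norm_fderiv_fderiv_le {E : Type*} [NormedAddCommGroup E]
    [NormedSpace ℝ E] {f : E → ℝ} (hf : ContDiff ℝ 2 f) {M : ℝ}
    (hM : ∀ x, ‖fderiv ℝ (fderiv ℝ f) x‖ ≤ M) (x v : E) :
    f (x + v) ≤ f x + fderiv ℝ f x v + M / 2 * ‖v‖ ^ 2 := by
  have hd : Differentiable ℝ f := hf.differentiable (by norm_num)
  have hd' : Differentiable ℝ (fderiv ℝ f) :=
    (hf.fderiv_right (m := 1) (by norm_num)).differentiable (by norm_num)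
  have hlip : ∀ y, ‖fderiv ℝ f y - fderiv ℝ f x‖ ≤ M * ‖y - x‖ := fun y =>
    convex_univ.norm_image_sub_le_of_norm_fderiv_le (fun z _ => hd' z) (fun z _ => hM z)
      (Set.mem_univ x) (Set.mem_univ y)
  have hder : ∀ t : ℝ, HasDerivAt
      (fun t : ℝ => f (x + t • v) - t * fderiv ℝ f x v - M / 2 * ‖v‖ ^ 2 * t ^ 2)
      (fderiv ℝ f (x + t • v) v - fderiv ℝ f x v - M / 2 * ‖v‖ ^ 2 * (2 * t)) t := by
    intro t
    have h1 : HasDerivAt (fun t : ℝ => x + t • v) v t := by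
      simpa using ((hasDerivAt_id t).smul_const v).const_add x
    have h2 := (hd (x + t • v)).hasFDerivAt.comp_hasDerivAt t h1
    have h3 := (hasDerivAt_id t).mul_const (fderiv ℝ f x v)
    have h4 := ((hasDerivAt_id t).pow 2).const_mul (M / 2 * ‖v‖ ^ 2)
    refine ((h2.sub h3).sub h4).congr_deriv ?_
    simp
  have hanti := antitoneOn_of_deriv_nonpos (convex_Icc (0 : ℝ) 1)
    (fun t _ => (hder t).continuousAt.continuousWithinAt)
    (fun t _ => (hder t).differentiableAt.differentiableWithinAt) (fun t ht => by
      rw [interior_Icc] at ht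
      rw [(hder t).deriv, ← sub_apply]
      have h1 := (le_abs_self _).trans
        ((fderiv ℝ f (x + t • v) - fderiv ℝ f x).le_opNorm v)
      have h2 := mul_le_mul_of_nonneg_right (hlip (x + t • v)) (norm_nonneg v)
      rw [add_sub_cancel_left, norm_smul, Real.norm_eq_abs, abs_of_pos ht.1] at h2
      nlinarith)
  have := hanti (Set.left_mem_Icc.2 zero_le_one) (Set.right_mem_Icc.2 zero_le_one) zero_le_one
  simp at this
  linarith

theorem mul_norm_sq_le_inner_sub {E : Type*} [NormedAddCommGroup E] [InnerProductSpace ℝ E]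
    {f : E → E} (hf : Differentiable ℝ f) {c : ℝ}
    (hc : ∀ x v, c * ‖v‖ ^ 2 ≤ inner ℝ (fderiv ℝ f x v) v) (x y : E) :
    c * ‖x - y‖ ^ 2 ≤ inner ℝ (f x - f y) (x - y) := by
  set v := x - y with hv
  have hder : ∀ t : ℝ, HasDerivAt (fun t : ℝ => inner ℝ (f (y + t • v)) v)
      (inner ℝ (fderiv ℝ f (y + t • v) v) v) t := by
    intro t
    have h1 : HasDerivAt (fun t : ℝ => y + t • v) v t := by
      simpa using ((hasDerivAt_id t).smul_const v).const_add y
    have h2 := (hf (y + t • v)).hasFDerivAt.comp_hasDerivAt t h1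
    simpa using h2.inner ℝ (hasDerivAt_const t v)
  have := mul_sub_le_image_sub_of_le_deriv (fun t => (hder t).differentiableAt)
    (C := c * ‖v‖ ^ 2) (fun t => by rw [(hder t).deriv]; exact hc _ _) zero_le_one
  simpa [hv, ← inner_sub_left] using this

/-- Pointwise arithmetic-geometric mean at level `c + ε`; the `ε` keeps the denominator positive
when `c = 0`. -/
theorem integral_le_of_integral_sq_le {α : Type*} [MeasurableSpace α] {μ : Measure α}
    [IsProbabilityMeasure μ] {f : α → ℝ} (hf : Integrable f μ)
    (hf2 : Integrable (fun x => f x ^ 2) μ) {c : ℝ} (hc : 0 ≤ c)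
    (h : ∫ x, f x ^ 2 ∂μ ≤ c ^ 2) : ∫ x, f x ∂μ ≤ c := by
  refine le_of_forall_pos_le_add fun ε hε => ?_
  have h1 : ∫ x, f x ∂μ ≤ ∫ x, (f x ^ 2 / (2 * (c + ε)) + (c + ε) / 2) ∂μ := by
    refine integral_mono hf ((hf2.div_const _).add (integrable_const _)) fun x => ?_
    rw [← sub_nonneg]
    have : f x ^ 2 / (2 * (c + ε)) + (c + ε) / 2 - f x = (f x - (c + ε)) ^ 2 / (2 * (c + ε)) := by
      field_simp
      ring
    simp only [this]
    positivity
  rw [integral_add (hf2.div_const _) (integrable_const _), integral_div] at h1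
  simp only [integral_const, probReal_univ, one_smul] at h1
  refine h1.trans ?_
  have : (∫ x, f x ^ 2 ∂μ) / (2 * (c + ε)) ≤ (c + ε) / 2 := by
    rw [div_le_iff₀ (by positivity)]
    nlinarith
  linarith

/-! ### Standing assumptions and their first consequences. -/

namespace RMData

variable {d q : ℕ} {D : RMData d q}

/-- The standing assumptions on a Robbins–Monro scheme. -/
structure Standing (D : RMData d q) : Prop where
  dim_pos : 0 < d
  prob : IsProbabilityMeasure D.μ
  meas : Measurable (Function.uncurry D.H)
  α_mem : D.α ∈ Set.Icc (1 / 2 : ℝ) 1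
  hl : D.HL
  hls : D.HLS
  hua : D.HUA
  γ_nonneg : ∀ n, 0 ≤ D.γ (n + 1)
  β_pos : 0 < D.β
  gc : GaussianConcentration D.β D.μ

namespace Standing

theorem kappa_mem (hD : D.Standing) : (1 - D.α) / 2 ∈ Set.Icc (0 : ℝ) (1 / 4) := by
  obtain ⟨h1, h2⟩ := hD.α_mem
  constructor <;> linarith

theorem L_pos (hD : D.Standing) (x) : 0 < D.L x := hD.hls.2.1 x

theorem CL_pos (hD : D.Standing) : 0 < D.CL := hD.hls.2.2.1

theorem Ch_pos (hD : D.Standing) : 0 < D.Ch := hD.hls.2.2.2.2.2.2.1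

theorem Cα_pos (hD : D.Standing) : 0 < D.Cα := hD.hls.2.2.2.2.2.2.2.2.1

theorem lam_pos (hD : D.Standing) : 0 < D.lam := hD.hua.2.1

theorem α_pos (hD : D.Standing) : 0 < D.α := lt_of_lt_of_le (by norm_num) hD.α_mem.1

theorem norm_gradient_sq_le (hD : D.Standing) (x) : ‖gradient D.L x‖ ^ 2 ≤ D.CL * D.L x :=
  hD.hls.2.2.2.1 x

theorem norm_h_sq_le (hD : D.Standing) (x) : ‖D.h x‖ ^ 2 ≤ D.Ch * D.L x :=
  hD.hls.2.2.2.2.2.2.2.1 x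

theorem inner_h_gradient_nonneg (hD : D.Standing) (x) : 0 ≤ inner ℝ (D.h x) (gradient D.L x) :=
  hD.hls.2.2.2.2.2.1 x

theorem norm_H_sub_le (hD : D.Standing) (x u v) :
    ‖D.H x u - D.H x v‖ ≤ D.Cα * D.L x ^ ((1 - D.α) / 2) * ‖u - v‖ :=
  hD.hls.2.2.2.2.2.2.2.2.2 x u v

theorem norm_H_sub_le' (hD : D.Standing) (u x y) :
    ‖D.H x u - D.H y u‖ ≤ D.CH * (1 + ‖u‖) * ‖x - y‖ := hD.hl.2 u x y

theorem continuous_L (hD : D.Standing) : Continuous D.L := hD.hls.1.continuous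

theorem measurable_H (hD : D.Standing) (x) : Measurable (D.H x) :=
  hD.meas.comp measurable_prodMk_left

theorem integrable_H (hD : D.Standing) (x) : Integrable (D.H x) D.μ := by
  have := hD.prob
  refine ((integrable_const ‖D.H x 0‖).add
    (hD.gc.integrable_norm.const_mul (D.Cα * D.L x ^ ((1 - D.α) / 2)))).mono'
    (hD.measurable_H x).aestronglyMeasurable (.of_forall fun u => ?_)
  have h1 := hD.norm_H_sub_le x u 0
  have h2 := norm_sub_norm_le (D.H x u) (D.H x 0)
  rw [sub_zero] at h1
  simp only [Pi.add_apply]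
  linarith

theorem integrable_norm_sq (hD : D.Standing) : Integrable (fun u => ‖u‖ ^ 2) D.μ :=
  have := hD.prob
  hD.gc.integrable_norm_sq hD.β_pos

theorem m2_nonneg (_hD : D.Standing) : 0 ≤ D.m2 := integral_nonneg fun u => by positivity

theorem η_nonneg (_hD : D.Standing) : 0 ≤ D.η :=
  mul_nonneg (by norm_num) (Real.iSup_nonneg fun x => by positivity)

theorem L_add_le (hD : D.Standing) (x v) :
    D.L (x + v) ≤ D.L x + inner ℝ (gradient D.L x) v + D.η * ‖v‖ ^ 2 := by
  have h := image_add_le_of_norm_fderiv_fderiv_le hD.hls.1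
    (fun x => le_ciSup hD.hls.2.2.2.2.1 x) x v
  rw [inner_gradient_left, η]
  linarith

theorem exists_L_le (hD : D.Standing) : ∃ A : ℝ, 1 ≤ A ∧ ∀ x, 1 + D.L x ≤ A * (1 + ‖x‖) ^ 2 := by
  have h0 := hD.L_pos 0
  have hη := hD.η_nonneg
  refine ⟨1 + D.L 0 + ‖gradient D.L 0‖ + D.η, by linarith [norm_nonneg (gradient D.L 0)], fun x => ?_⟩
  have h1 := hD.L_add_le 0 x
  have h2 := real_inner_le_norm (gradient D.L 0) x
  rw [zero_add] at h1
  have h3 := norm_nonneg x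
  have h4 := norm_nonneg (gradient D.L 0)
  nlinarith [mul_nonneg h0.le h3, mul_nonneg h4 h3, mul_nonneg hη h3, mul_nonneg h0.le (sq_nonneg ‖x‖),
    mul_nonneg h4 (sq_nonneg ‖x‖), sq_nonneg ‖x‖]

theorem norm_h_sub_H_zero_le (hD : D.Standing) (x) :
    ‖D.h x - D.H x 0‖ ≤ D.Cα * D.L x ^ ((1 - D.α) / 2) * ∫ u, ‖u‖ ∂D.μ := by
  have := hD.prob
  have e : D.h x - D.H x 0 = ∫ u, (D.H x u - D.H x 0) ∂D.μ := by
    rw [integral_sub (hD.integrable_H x) (integrable_const _)]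
    simp [h]
  rw [e, ← integral_const_mul]
  refine norm_integral_le_of_norm_le (hD.gc.integrable_norm.const_mul _) (.of_forall fun u => ?_)
  simpa using hD.norm_H_sub_le x u 0

theorem lam_mul_norm_sq_le (hD : D.Standing) (x y) :
    D.lam * ‖x - y‖ ^ 2 ≤ inner ℝ (D.h x - D.h y) (x - y) :=
  mul_norm_sq_le_inner_sub (hD.hua.1.differentiable (by norm_num)) hD.hua.2.2 x y

theorem lam_mul_norm_le (hD : D.Standing) (x y) : D.lam * ‖x - y‖ ≤ ‖D.h x - D.h y‖ := by
  rcases eq_or_ne x y with rfl | hxy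
  · simp
  have h1 := (hD.lam_mul_norm_sq_le x y).trans (real_inner_le_norm _ _)
  have h2 : 0 < ‖x - y‖ := norm_pos_iff.2 (sub_ne_zero.2 hxy)
  nlinarith

theorem exists_norm_eq_one (hD : D.Standing) : ∃ v : EuclideanSpace ℝ (Fin d), ‖v‖ = 1 := by
  have := hD.dim_pos
  have : Nonempty (Fin d) := ⟨⟨0, this⟩⟩
  exact exists_norm_eq _ zero_le_one

/-- The mean field grows at most like `C_H |θ|`, since the noise has sublinear growth. -/
theorem lam_le_CH (hD : D.Standing) : D.lam ≤ D.CH := by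
  by_contra hlt
  push Not at hlt
  obtain ⟨v, hv⟩ := hD.exists_norm_eq_one
  obtain ⟨A, hA1, hA⟩ := hD.exists_L_le
  set m := ∫ u, ‖u‖ ∂D.μ with hm
  have hm0 : 0 ≤ m := integral_nonneg fun u => norm_nonneg u
  have hC := hD.Cα_pos
  obtain ⟨hκ0, hκ1⟩ := hD.kappa_mem
  -- `L` grows at most quadratically and the exponent is at most `1/4` since `α ≥ 1/2`.
  have hgrow : ∀ x, D.L x ^ ((1 - D.α) / 2) ≤ A * Real.sqrt (1 + ‖x‖) := by
    intro x
    have hL := hD.L_pos x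
    have h1 : 1 ≤ A * (1 + ‖x‖) ^ 2 := by linarith [hA x]
    calc D.L x ^ ((1 - D.α) / 2) ≤ (A * (1 + ‖x‖) ^ 2) ^ ((1 - D.α) / 2) :=
          Real.rpow_le_rpow hL.le (by linarith [hA x]) hκ0
      _ ≤ (A * (1 + ‖x‖) ^ 2) ^ (1 / 4 : ℝ) := Real.rpow_le_rpow_of_exponent_le h1 hκ1
      _ = A ^ (1 / 4 : ℝ) * Real.sqrt (1 + ‖x‖) := by
          rw [Real.mul_rpow (by linarith) (by positivity), ← Real.rpow_natCast,
            ← Real.rpow_mul (by positivity), Real.sqrt_eq_rpow]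
          norm_num
      _ ≤ A * Real.sqrt (1 + ‖x‖) := by
          gcongr
          exact (Real.rpow_le_rpow_of_exponent_le hA1 (by norm_num)).trans_eq (Real.rpow_one A)
  set R := 2 * (D.Cα * A * m) + (D.lam - D.CH) with hR
  have hδ : 0 < D.lam - D.CH := by linarith
  have hR0 : 0 < R := by positivity
  have key : ∀ s : ℝ, 1 ≤ s → (D.lam - D.CH) * s ≤ R := by
    intro s hs
    -- This parametrisation turns `√(1 + ‖t • v‖)` into `s`, so the comparison of linear growth with
    -- square-root growth becomes polynomial.
    set t := s ^ 2 - 1 with ht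
    have ht0 : 0 ≤ t := by nlinarith
    have hnv : ‖t • v‖ = t := by rw [norm_smul, hv, mul_one, Real.norm_eq_abs, abs_of_nonneg ht0]
    have h1 := hD.lam_mul_norm_le (t • v) 0
    have h2 := hD.norm_h_sub_H_zero_le (t • v)
    have h3 := hD.norm_h_sub_H_zero_le 0
    have h4 := hD.norm_H_sub_le' 0 (t • v) 0
    have h5 := hgrow (t • v)
    have h6 := hgrow 0
    rw [hnv, ht, add_sub_cancel, Real.sqrt_sq (by linarith)] at h5
    rw [norm_zero, add_zero, Real.sqrt_one, mul_one] at h6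
    simp only [sub_zero, norm_zero, add_zero, mul_one, hnv] at h1 h4
    have h7 : ‖D.h (t • v) - D.h 0‖ ≤ ‖D.h (t • v) - D.H (t • v) 0‖ +
        ‖D.H (t • v) 0 - D.H 0 0‖ + ‖D.h 0 - D.H 0 0‖ := by
      have : D.h (t • v) - D.h 0 = (D.h (t • v) - D.H (t • v) 0) +
        (D.H (t • v) 0 - D.H 0 0) - (D.h 0 - D.H 0 0) := by abel
      rw [this]
      exact (norm_sub_le _ _).trans (add_le_add_left (norm_add_le _ _) _)
    have h8 : D.Cα * D.L (t • v) ^ ((1 - D.α) / 2) * m ≤ D.Cα * (A * s) * m := by gcongr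
    have h9 : D.Cα * D.L 0 ^ ((1 - D.α) / 2) * m ≤ D.Cα * A * m := by gcongr
    have h10 : (D.lam - D.CH) * t ≤ D.Cα * A * m * s + D.Cα * A * m := by
      nlinarith
    have h11 : 0 ≤ D.Cα * A * m := by positivity
    have h12 : (D.lam - D.CH) * s * s ≤ R * s := by
      rw [ht] at h10
      nlinarith
    exact le_of_mul_le_mul_right h12 (by linarith)
  have h1 := key (R / (D.lam - D.CH) + 1) (by
    have : 0 ≤ R / (D.lam - D.CH) := by positivity
    linarith)
  rw [mul_add, mul_div_cancel₀ _ hδ.ne'] at h1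
  linarith

/-- If `η = 0`, then `L` lies below its tangent planes, and positivity of `L` forces its gradient to
vanish. So `L` is bounded, hence so is `h` by `|h|² ≤ C_h L`, against strong monotonicity. Needed
because `η` stands in the denominator of `Λ_N`. -/
theorem η_pos (hD : D.Standing) : 0 < D.η := by
  refine lt_of_le_of_ne hD.η_nonneg fun h0 => ?_
  have hT := hD.L_add_le
  simp only [← h0, zero_mul, add_zero] at hT
  have hgrad : ∀ x, gradient D.L x = 0 := by
    intro x
    by_contra hne
    have hpos : 0 < ‖gradient D.L x‖ ^ 2 := by have := norm_pos_iff.2 hne; positivity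
    have h1 := hT x (-(D.L x / ‖gradient D.L x‖ ^ 2) • gradient D.L x)
    rw [inner_smul_right, real_inner_self_eq_norm_sq, neg_mul, div_mul_cancel₀ _ hpos.ne'] at h1
    linarith [hD.L_pos (x + -(D.L x / ‖gradient D.L x‖ ^ 2) • gradient D.L x)]
  have hL : ∀ x, D.L x ≤ D.L 0 := fun x => by simpa [hgrad] using hT 0 x
  obtain ⟨v, hv⟩ := hD.exists_norm_eq_one
  set R := Real.sqrt (D.Ch * D.L 0) with hR
  have hb : ∀ x, ‖D.h x‖ ≤ R := fun x => Real.le_sqrt_of_sq_le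
    ((hD.norm_h_sq_le x).trans (mul_le_mul_of_nonneg_left (hL x) hD.Ch_pos.le))
  have hl := hD.lam_pos
  have hR0 : 0 ≤ R := Real.sqrt_nonneg _
  have h1 := hD.lam_mul_norm_le (((2 * R + 1) / D.lam) • v) 0
  rw [sub_zero, norm_smul, hv, mul_one, Real.norm_eq_abs, abs_of_nonneg (by positivity),
    mul_div_cancel₀ _ hl.ne'] at h1
  have h2 := norm_sub_le (D.h (((2 * R + 1) / D.lam) • v)) (D.h 0)
  linarith [hb 0, hb (((2 * R + 1) / D.lam) • v)]

end Standing

/-! ### One step of the scheme: contraction and dependence on the innovation. -/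

/-- The factor of `Π_1` at step `n`. -/
noncomputable def fac (D : RMData d q) (n : ℕ) : ℝ :=
  1 - 2 * D.lam * D.γ (n + 1) + D.CHμ * D.γ (n + 1) ^ 2

/-- One step of the scheme from `θ` with innovation `u`. -/
noncomputable def step (D : RMData d q) (n : ℕ) (θ : EuclideanSpace ℝ (Fin d)) (u : EuclideanSpace ℝ (Fin q)) :
    EuclideanSpace ℝ (Fin d) :=
  θ - D.γ (n + 1) • D.H θ u

theorem Pi1_succ (D : RMData d q) (n : ℕ) : D.Pi1 (n + 1) = D.Pi1 n * D.fac n :=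
  prod_range_succ _ _

namespace Standing

/-- Since `λ ≤ C_H`, `C_{H,μ} ≥ 2λ²`, and `1 - 2x + 2x² ≥ 1/2` at `x = λγ`. Thus `Π_1` is positive
without any smallness of the steps. -/
theorem half_le_fac (hD : D.Standing) (n : ℕ) : 1 / 2 ≤ D.fac n := by
  have h1 := hD.lam_le_CH
  have h2 := hD.lam_pos
  have h3 := hD.m2_nonneg
  have h4 : 2 * D.lam ^ 2 ≤ D.CHμ := by
    rw [CHμ]
    nlinarith [mul_nonneg (sq_nonneg D.CH) h3]
  have h5 := mul_le_mul_of_nonneg_right h4 (sq_nonneg (D.γ (n + 1)))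
  rw [fac]
  nlinarith [sq_nonneg (2 * D.lam * D.γ (n + 1) - 1)]

theorem fac_pos (hD : D.Standing) (n : ℕ) : 0 < D.fac n :=
  lt_of_lt_of_le (by norm_num) (hD.half_le_fac n)

theorem Pi1_pos (hD : D.Standing) (n : ℕ) : 0 < D.Pi1 n := prod_pos fun k _ => hD.fac_pos k

theorem integrable_step (hD : D.Standing) (n : ℕ) (x) : Integrable (D.step n x) D.μ :=
  have := hD.prob
  (integrable_const x).sub ((hD.integrable_H x).smul (D.γ (n + 1)))

theorem measurable_step (hD : D.Standing) (n : ℕ) : Measurable (Function.uncurry (D.step n)) :=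
  measurable_fst.sub (hD.meas.const_smul (D.γ (n + 1)))

theorem norm_step_sub_le (hD : D.Standing) (n : ℕ) (x u v) :
    ‖D.step n x u - D.step n x v‖ ≤
      D.γ (n + 1) * D.Cα * D.L x ^ ((1 - D.α) / 2) * ‖u - v‖ := by
  have e : D.step n x u - D.step n x v = -(D.γ (n + 1) • (D.H x u - D.H x v)) := by
    simp only [step, smul_sub]; abel
  rw [e, norm_neg, norm_smul, Real.norm_eq_abs, abs_of_nonneg (hD.γ_nonneg n), mul_assoc, mul_assoc,
    ← mul_assoc D.Cα]
  exact mul_le_mul_of_nonneg_left (hD.norm_H_sub_le x u v) (hD.γ_nonneg n)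

/-- One step contracts the distance of two copies driven by the same innovation. -/
theorem integral_norm_step_sub_le (hD : D.Standing) (n : ℕ) (x y) :
    ∫ u, ‖D.step n x u - D.step n y u‖ ∂D.μ ≤ Real.sqrt (D.fac n) * ‖x - y‖ := by
  have := hD.prob
  set g := D.γ (n + 1) with hg
  have hC := hD.hl.1
  have hi : Integrable (fun u => D.H x u - D.H y u) D.μ :=
    (hD.integrable_H x).sub (hD.integrable_H y)
  have hsq : ∀ u, ‖D.step n x u - D.step n y u‖ ^ 2 ≤ ‖x - y‖ ^ 2 -
      2 * g * inner ℝ (x - y) (D.H x u - D.H y u) +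
      g ^ 2 * (2 * D.CH ^ 2 * (1 + ‖u‖ ^ 2) * ‖x - y‖ ^ 2) := by
    intro u
    have e : D.step n x u - D.step n y u = (x - y) - g • (D.H x u - D.H y u) := by
      simp only [step, smul_sub, hg]; abel
    have h1 : ‖D.H x u - D.H y u‖ ^ 2 ≤ 2 * D.CH ^ 2 * (1 + ‖u‖ ^ 2) * ‖x - y‖ ^ 2 := by
      calc ‖D.H x u - D.H y u‖ ^ 2 ≤ (D.CH * (1 + ‖u‖) * ‖x - y‖) ^ 2 := by
            gcongr; exact hD.norm_H_sub_le' u x y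
        _ = D.CH ^ 2 * (1 + ‖u‖) ^ 2 * ‖x - y‖ ^ 2 := by ring
        _ ≤ D.CH ^ 2 * (2 * (1 + ‖u‖ ^ 2)) * ‖x - y‖ ^ 2 := by
            gcongr; nlinarith [sq_nonneg (1 - ‖u‖)]
        _ = _ := by ring
    rw [e, norm_sub_sq_real, inner_smul_right, norm_smul, mul_pow, Real.norm_eq_abs, sq_abs]
    have := mul_le_mul_of_nonneg_left h1 (sq_nonneg g)
    linarith
  have hi1 : Integrable (fun u => inner ℝ (x - y) (D.H x u - D.H y u)) D.μ := hi.const_inner _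
  have hi2 : Integrable (fun u => g ^ 2 * (2 * D.CH ^ 2 * (1 + ‖u‖ ^ 2) * ‖x - y‖ ^ 2)) D.μ :=
    ((((integrable_const (1 : ℝ)).add hD.integrable_norm_sq).const_mul _).mul_const _).const_mul _
  have hi0 : Integrable
      (fun u => ‖x - y‖ ^ 2 - 2 * g * inner ℝ (x - y) (D.H x u - D.H y u)) D.μ :=
    (integrable_const _).sub (hi1.const_mul (2 * g))
  have hi3 := hi0.add hi2
  have hm : AEStronglyMeasurable (fun u => D.step n x u - D.step n y u) D.μ :=
    ((hD.integrable_step n x).sub (hD.integrable_step n y)).aestronglyMeasurable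
  have hi4 : Integrable (fun u => ‖D.step n x u - D.step n y u‖ ^ 2) D.μ :=
    hi3.mono' (hm.norm.pow 2) (.of_forall fun u => by
      rw [Real.norm_eq_abs, abs_of_nonneg (by positivity)]; exact hsq u)
  refine integral_le_of_integral_sq_le
    ((hD.integrable_step n x).sub (hD.integrable_step n y)).norm hi4 (by positivity) ?_
  refine (integral_mono hi4 hi3 hsq).trans ?_
  simp only [Pi.add_apply]
  rw [integral_add hi0 hi2,
    integral_sub (integrable_const _) (hi1.const_mul _), integral_const_mul, integral_const_mul,
    integral_mul_const, integral_const_mul, integral_add (integrable_const _) hD.integrable_norm_sq,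
    integral_inner hi, integral_sub (hD.integrable_H x) (hD.integrable_H y)]
  simp only [integral_const, probReal_univ, one_smul]
  have h1 := hD.lam_mul_norm_sq_le x y
  rw [real_inner_comm] at h1
  have h2 := mul_le_mul_of_nonneg_left h1 (hD.γ_nonneg n)
  rw [mul_pow, Real.sq_sqrt (hD.fac_pos n).le, fac, CHμ]
  simp only [h, m2] at h2 ⊢
  nlinarith

end Standing
end RMData

/-! ### Calculus of logarithmic moment generating functions. -/

/-- The logarithmic moment generating function of `f` is at most `c`. -/
def ExpBound {α : Type*} [MeasurableSpace α] (m : Measure α) (f : α → ℝ) (c : ℝ) : Prop :=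
  ∫⁻ x, ENNReal.ofReal (Real.exp (f x)) ∂m ≤ ENNReal.ofReal (Real.exp c)

namespace ExpBound

variable {α : Type*} [MeasurableSpace α] {m : Measure α} {f g : α → ℝ} {a b c : ℝ}

theorem mono (h : ExpBound m g c) (hfg : ∀ x, f x ≤ g x) : ExpBound m f c :=
  (lintegral_mono fun x => ENNReal.ofReal_le_ofReal (Real.exp_le_exp.2 (hfg x))).trans h

theorem mono_right (h : ExpBound m f b) (hbc : b ≤ c) : ExpBound m f c :=
  le_trans h (ENNReal.ofReal_le_ofReal (Real.exp_le_exp.2 hbc))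

theorem const [IsProbabilityMeasure m] (c : ℝ) : ExpBound m (fun _ => c) c := by
  simp [ExpBound]

theorem add_const (h : ExpBound m f b) (c : ℝ) : ExpBound m (fun x => f x + c) (b + c) := by
  unfold ExpBound at *
  simp only [Real.exp_add, ENNReal.ofReal_mul (Real.exp_pos _).le]
  rw [lintegral_mul_const' _ _ ENNReal.ofReal_ne_top]
  gcongr

theorem of_integral_le (hi : Integrable (fun x => Real.exp (f x)) m)
    (h : ∫ x, Real.exp (f x) ∂m ≤ Real.exp c) : ExpBound m f c := by
  rw [ExpBound, ← ofReal_integral_eq_lintegral_ofReal hi (.of_forall fun x => (Real.exp_pos _).le)]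
  exact ENNReal.ofReal_le_ofReal h

theorem integral_le (h : ExpBound m f c) (hf : Measurable f) :
    ∫ x, Real.exp (f x) ∂m ≤ Real.exp c := by
  rw [integral_eq_lintegral_of_nonneg_ae (.of_forall fun x => (Real.exp_pos _).le)
    hf.exp.aestronglyMeasurable]
  exact ENNReal.toReal_le_of_le_ofReal (Real.exp_pos _).le h

/-- Hölder's inequality for logarithmic moment generating functions. -/
theorem convex_comb (hf : Measurable f) (hg : Measurable g) (ha : ExpBound m f a)
    (hb : ExpBound m g b) {p q : ℝ} (hp : 0 ≤ p) (hq : 0 ≤ q) (hpq : p + q = 1) :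
    ExpBound m (fun x => p * f x + q * g x) (p * a + q * b) := by
  have e : ∀ s t : ℝ, ENNReal.ofReal (Real.exp (p * s + q * t)) =
      ENNReal.ofReal (Real.exp s) ^ p * ENNReal.ofReal (Real.exp t) ^ q := by
    intro s t
    rw [ENNReal.ofReal_rpow_of_pos (Real.exp_pos _), ENNReal.ofReal_rpow_of_pos (Real.exp_pos _),
      ← ENNReal.ofReal_mul (by positivity), ← Real.exp_mul, ← Real.exp_mul, ← Real.exp_add,
      mul_comm s, mul_comm t]
  unfold ExpBound at *
  simp only [e]
  refine (ENNReal.lintegral_mul_norm_pow_le hf.exp.ennreal_ofReal.aemeasurable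
    hg.exp.ennreal_ofReal.aemeasurable hp hq hpq).trans ?_
  gcongr

theorem const_mul [IsProbabilityMeasure m] (hf : Measurable f) (ha : ExpBound m f a) {p : ℝ}
    (hp : 0 ≤ p) (hp1 : p ≤ 1) : ExpBound m (fun x => p * f x) (p * a) := by
  simpa using convex_comb hf measurable_const ha (const 0) hp (sub_nonneg.2 hp1) (by ring)

theorem prod_map {β γ : Type*} [MeasurableSpace β] [MeasurableSpace γ] {m : Measure α}
    {μ : Measure β} [SFinite m] [SFinite μ] {T : α → β → γ}
    (hT : Measurable (Function.uncurry T)) {f : γ → ℝ} (hf : Measurable f) {g : α → ℝ} {c : ℝ}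
    (h1 : ∀ x, ExpBound μ (fun u => f (T x u)) (g x)) (h2 : ExpBound m g c) :
    ExpBound ((m.prod μ).map (Function.uncurry T)) f c := by
  have hfT : Measurable fun z : α × β => ENNReal.ofReal (Real.exp (f (Function.uncurry T z))) :=
    hf.exp.ennreal_ofReal.comp hT
  rw [ExpBound, lintegral_map hf.exp.ennreal_ofReal hT, lintegral_prod _ hfT.aemeasurable]
  exact (lintegral_mono fun x => h1 x).trans h2

end ExpBound

theorem GaussianConcentration.expBound {E : Type*} [NormedAddCommGroup E] [MeasurableSpace E]
    {β : ℝ} {μ : Measure E} (h : GaussianConcentration β μ) [IsProbabilityMeasure μ] {g : E → ℝ}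
    {K : ℝ} (hK : 0 ≤ K) (hg : ∀ u v, |g u - g v| ≤ K * ‖u - v‖) {s : ℝ} (hs : 0 ≤ s) :
    ExpBound μ (fun u => s * g u) (s * ∫ u, g u ∂μ + β / 4 * s ^ 2 * K ^ 2) := by
  obtain ⟨h1, h2⟩ := (h.of_lipschitz hK hg).2 s hs
  exact .of_integral_le h1 h2

/-- Concavity: the tangent line at `x` lies above the power function. This is Bernoulli's inequality
at `y / x`. -/
theorem rpow_le_add_mul_sub {x y p : ℝ} (hx : 0 < x) (hy : 0 < y) (hp : 0 ≤ p) (hp1 : p ≤ 1) :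
    y ^ p ≤ x ^ p + p * x ^ (p - 1) * (y - x) := by
  have h1 := rpow_one_add_le_one_add_mul_self (s := (y - x) / x)
    (by rw [le_div_iff₀ hx]; linarith) hp hp1
  have h2 : 1 + (y - x) / x = y / x := by field_simp; ring
  rw [h2, Real.div_rpow hy.le hx.le, div_le_iff₀ (by positivity)] at h1
  rw [Real.rpow_sub_one hx.ne']
  refine h1.trans (le_of_eq ?_)
  field_simp

/-! ### The law of the scheme and exponential moments of the Lyapunov function. -/

namespace RMData

variable {d q : ℕ} {D : RMData d q}

/-- The law of `θ_n`. -/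
noncomputable def law (D : RMData d q) : ℕ → Measure (EuclideanSpace ℝ (Fin d))
  | 0 => Measure.dirac D.θ₀
  | n + 1 => ((law D n).prod D.μ).map (Function.uncurry (D.step n))

namespace Standing

theorem isProbabilityMeasure_law (hD : D.Standing) : ∀ n, IsProbabilityMeasure (D.law n)
  | 0 => Measure.dirac.isProbabilityMeasure
  | n + 1 => by
    have := hD.prob
    have := hD.isProbabilityMeasure_law n
    exact Measure.isProbabilityMeasure_map (hD.measurable_step n).aemeasurable

/-- `θ_n` is measurable for the σ-algebra of `U 1, …, U n`, hence independent of `U (n + 1)`. This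
reduces the theorem to the Markov recursion `law`. -/
theorem map_iter_eq_law (hD : D.Standing) {Ω : Type*} [MeasurableSpace Ω] {P : Measure Ω}
    [IsProbabilityMeasure P] {U : ℕ → Ω → EuclideanSpace ℝ (Fin q)}
    (hUmeas : ∀ n, Measurable (U (n + 1))) (hUindep : iIndepFun (fun n => U (n + 1)) P)
    (hUlaw : ∀ n, P.map (U (n + 1)) = D.μ) (n : ℕ) : P.map (D.iter U n) = D.law n := by
  have hsm : ∀ n, StronglyMeasurable (U (n + 1)) := fun n => (hUmeas n).stronglyMeasurable
  have hiter : ∀ n, Measurable[⨆ k < n, MeasurableSpace.comap (U (k + 1)) inferInstance]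
      (D.iter U n) := by
    intro n
    induction n with
    | zero => exact measurable_const
    | succ n ih =>
      have h1 : Measurable[⨆ k < n + 1, MeasurableSpace.comap (U (k + 1)) inferInstance]
          (D.iter U n) :=
        ih.mono (biSup_mono fun k hk => hk.trans n.lt_succ_self) le_rfl
      have h2 : Measurable[⨆ k < n + 1, MeasurableSpace.comap (U (k + 1)) inferInstance]
          (U (n + 1)) :=
        (comap_measurable (U (n + 1))).mono (le_iSup₂_of_le n n.lt_succ_self le_rfl) le_rfl
      exact (hD.measurable_step n).comp (h1.prodMk h2)
  have hle : ∀ n, (⨆ k < n, MeasurableSpace.comap (U (k + 1)) inferInstance) ≤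
      (inferInstance : MeasurableSpace Ω) := fun n =>
    iSup₂_le fun k _ => (hUmeas k).comap_le
  induction n with
  | zero => simp [iter, law, Measure.map_const]
  | succ n ih =>
    have hind : IndepFun (D.iter U n) (U (n + 1)) P := by
      have h1 := indep_iSup_of_disjoint (S := {k | k < n}) (T := {n})
        (fun k => (hUmeas k).comap_le) hUindep (by simp)
      rw [_root_.iSup_singleton] at h1
      exact indep_of_indep_of_le_left h1 (hiter n).comap_le
    have hm : Measurable (D.iter U n) := (hiter n).mono (hle n) le_rfl
    have h2 := (indepFun_iff_map_prod_eq_prod_map_map hm.aemeasurable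
      (hUmeas n).aemeasurable).1 hind
    rw [law, ← ih, ← hUlaw n, ← h2, Measure.map_map (hD.measurable_step n)
      (hm.prodMk (hUmeas n))]
    rfl

theorem expBound_law_succ (hD : D.Standing) {n : ℕ} {f g : EuclideanSpace ℝ (Fin d) → ℝ}
    (hf : Measurable f) {c : ℝ} (h1 : ∀ x, ExpBound D.μ (fun u => f (D.step n x u)) (g x))
    (h2 : ExpBound (D.law n) g c) : ExpBound (D.law (n + 1)) f c :=
  have := hD.prob
  have := hD.isProbabilityMeasure_law n
  ExpBound.prod_map (hD.measurable_step n) hf h1 h2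

theorem logMom_nonneg (hD : D.Standing) {s : ℝ} (hs0 : 0 ≤ s) (hs : s ≤ D.epsβ) :
    0 ≤ D.logMom s := by
  have := hD.prob
  refine Real.log_nonneg ?_
  calc (1 : ℝ) = ∫ _, 1 ∂D.μ := by simp
    _ ≤ _ := integral_mono (integrable_const _) (hD.gc.integrable_exp_norm_sq hD.β_pos hs)
      fun u => Real.one_le_exp (by positivity)

theorem expBound_logMom (hD : D.Standing) {s : ℝ} (hs : s ≤ D.epsβ) :
    ExpBound D.μ (fun u => s * ‖u‖ ^ 2) (D.logMom s) := by
  have := hD.prob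
  have hi := hD.gc.integrable_exp_norm_sq hD.β_pos hs
  refine .of_integral_le hi ?_
  rw [logMom, Real.exp_log (integral_exp_pos hi)]

theorem m1_sq_le (hD : D.Standing) : (∫ u, ‖u‖ ∂D.μ) ^ 2 ≤ D.m2 := by
  have := hD.prob
  have h := integral_le_of_integral_sq_le hD.gc.integrable_norm hD.integrable_norm_sq
    (Real.sqrt_nonneg D.m2) (by rw [Real.sq_sqrt hD.m2_nonneg, m2])
  have h0 : 0 ≤ ∫ u, ‖u‖ ∂D.μ := integral_nonneg fun u => norm_nonneg u
  calc (∫ u, ‖u‖ ∂D.μ) ^ 2 ≤ Real.sqrt D.m2 ^ 2 := by gcongr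
    _ = D.m2 := Real.sq_sqrt hD.m2_nonneg

/-- `H(x, u) - h(x)` is the average of `H(x, u) - H(x, v)` over an independent copy `v`, to which
the Lipschitz bound in `u` applies. -/
theorem norm_H_sub_h_sq_le (hD : D.Standing) (x u) :
    ‖D.H x u - D.h x‖ ^ 2 ≤ 2 * D.Cα ^ 2 * D.L x ^ (1 - D.α) * (‖u‖ ^ 2 + D.m2) := by
  have := hD.prob
  have hC := hD.Cα_pos
  have hL := hD.L_pos x
  have hi := hD.gc.integrable_norm
  set m := ∫ u, ‖u‖ ∂D.μ with hm
  have hm0 : 0 ≤ m := integral_nonneg fun u => norm_nonneg u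
  have h1 : ‖D.H x u - D.h x‖ ≤ D.Cα * D.L x ^ ((1 - D.α) / 2) * (‖u‖ + m) := by
    have e : D.H x u - D.h x = ∫ v, (D.H x u - D.H x v) ∂D.μ := by
      rw [integral_sub (integrable_const _) (hD.integrable_H x)]
      simp [h]
    have e2 : D.Cα * D.L x ^ ((1 - D.α) / 2) * (‖u‖ + m) =
        ∫ v, D.Cα * D.L x ^ ((1 - D.α) / 2) * (‖u‖ + ‖v‖) ∂D.μ := by
      rw [integral_const_mul, integral_add (integrable_const _) hi]
      simp [hm]
    rw [e, e2]
    refine norm_integral_le_of_norm_le (((integrable_const _).add hi).const_mul _)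
      (.of_forall fun v => (hD.norm_H_sub_le x u v).trans ?_)
    gcongr
    exact norm_sub_le u v
  have h2 : (D.L x ^ ((1 - D.α) / 2)) ^ 2 = D.L x ^ (1 - D.α) := by
    rw [← Real.rpow_natCast, ← Real.rpow_mul hL.le]
    congr 1; push_cast; ring
  calc ‖D.H x u - D.h x‖ ^ 2 ≤ (D.Cα * D.L x ^ ((1 - D.α) / 2) * (‖u‖ + m)) ^ 2 := by gcongr
    _ = D.Cα ^ 2 * D.L x ^ (1 - D.α) * (‖u‖ + m) ^ 2 := by rw [← h2]; ring
    _ ≤ D.Cα ^ 2 * D.L x ^ (1 - D.α) * (2 * (‖u‖ ^ 2 + D.m2)) := by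
        gcongr
        nlinarith [sq_nonneg (‖u‖ - m), hD.m1_sq_le]
    _ = _ := by ring

/-- The Lyapunov increment. -/
theorem L_step_rpow_le (hD : D.Standing) (n : ℕ) (x u) :
    D.L (D.step n x u) ^ D.α ≤
      (1 + 2 * D.η * D.α * D.Ch * D.γ (n + 1) ^ 2) * D.L x ^ D.α + D.Cbar * D.γ (n + 1) ^ 2 +
      (-(D.γ (n + 1) * D.α * D.L x ^ (D.α - 1)) * inner ℝ (gradient D.L x) (D.H x u - D.h x) +
        4 * D.η * D.α * D.Cα ^ 2 * D.γ (n + 1) ^ 2 * ‖u‖ ^ 2) := by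
  have hα := hD.α_pos
  have hη := hD.η_nonneg
  have hγ := hD.γ_nonneg n
  set g := D.γ (n + 1)
  have hL := hD.L_pos x
  set w := D.L x ^ (D.α - 1) with hw
  have hw0 : 0 < w := by positivity
  have hwx : D.L x ^ D.α = w * D.L x := by
    rw [hw, ← Real.rpow_add_one hL.ne']; congr 1; ring
  -- The reason for taking the power `α`: the weight `L^(α-1)` from concavity cancels the growth
  -- `L^(1-α)` of the squared noise exactly.
  have hwx' : w * D.L x ^ (1 - D.α) = 1 := by
    rw [hw, ← Real.rpow_add hL]; simp
  have h1 := rpow_le_add_mul_sub hL (hD.L_pos (D.step n x u)) hα.le hD.α_mem.2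
  have h2 := hD.L_add_le x (-(g • D.H x u))
  rw [← sub_eq_add_neg, inner_neg_right, inner_smul_right, norm_neg, norm_smul, mul_pow,
    Real.norm_eq_abs, sq_abs] at h2
  have h3 : ‖D.H x u‖ ^ 2 ≤
      2 * D.Ch * D.L x + 4 * D.Cα ^ 2 * D.L x ^ (1 - D.α) * (‖u‖ ^ 2 + D.m2) := by
    have e1 := norm_add_le (D.h x) (D.H x u - D.h x)
    rw [add_sub_cancel] at e1
    have e2 := hD.norm_h_sq_le x
    have e3 := hD.norm_H_sub_h_sq_le x u
    have e4 : ‖D.H x u‖ ^ 2 ≤ (‖D.h x‖ + ‖D.H x u - D.h x‖) ^ 2 := by gcongr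
    nlinarith [sq_nonneg (‖D.h x‖ - ‖D.H x u - D.h x‖)]
  -- The drift has a favourable sign and is dropped; only the centred noise remains to first order.
  have h4 : inner ℝ (gradient D.L x) (D.H x u - D.h x) ≤ inner ℝ (gradient D.L x) (D.H x u) := by
    rw [inner_sub_right, real_inner_comm (D.h x)]
    linarith [hD.inner_h_gradient_nonneg x]
  have h5 : D.L (D.step n x u) - D.L x ≤
      -(g * inner ℝ (gradient D.L x) (D.H x u - D.h x)) + D.η * (g ^ 2 *
        (2 * D.Ch * D.L x + 4 * D.Cα ^ 2 * D.L x ^ (1 - D.α) * (‖u‖ ^ 2 + D.m2))) := by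
    have e1 := mul_le_mul_of_nonneg_left h4 hγ
    have e2 := mul_le_mul_of_nonneg_left h3 (mul_nonneg hη (sq_nonneg g))
    have e3 : D.L (D.step n x u) = D.L (x - g • D.H x u) := rfl
    linarith
  have h6 := mul_le_mul_of_nonneg_left h5 (mul_pos hα hw0).le
  refine (h1.trans (add_le_add_right h6 _)).trans (le_of_eq ?_)
  rw [hwx, Cbar]
  linear_combination (4 * D.η * D.α * g ^ 2 * D.Cα ^ 2 * (‖u‖ ^ 2 + D.m2)) * hwx'

/-- The one-step exponential moment of the Lyapunov function. -/
theorem expBound_L_step (hD : D.Standing) {n : ℕ} {s G ρ : ℝ} (hs0 : 0 ≤ s) (hs1 : s ≤ 1)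
    (hG1 : 1 ≤ G) (hG : D.γ (n + 1) ^ 2 ≤ G) (hρ0 : 0 ≤ ρ) (hρ1 : ρ ≤ 1)
    (hρ : ρ * (8 * D.η * D.α * D.Cα ^ 2 * G) ≤ s * D.epsβ) (x) :
    ExpBound D.μ (fun u => ρ * D.L (D.step n x u) ^ D.α)
      (ρ * (1 + (2 * D.η * D.α * D.Ch + D.β / 2 * D.α ^ 2 * D.CL * D.Cα ^ 2) *
        D.γ (n + 1) ^ 2) * D.L x ^ D.α +
        (ρ * D.Cbar * D.γ (n + 1) ^ 2 + 1 / 2 * D.γ (n + 1) ^ 2 * D.logMom (s * D.epsβ))) := by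
  have := hD.prob
  have hα := hD.α_pos
  have hη := hD.η_nonneg
  have hγ := hD.γ_nonneg n
  have hCα := hD.Cα_pos
  have hCL := hD.CL_pos
  have hβ := hD.β_pos
  have hε : 0 ≤ D.epsβ := by rw [epsβ]; positivity
  have hsε : s * D.epsβ ≤ D.epsβ := by nlinarith
  have hlm := hD.logMom_nonneg (mul_nonneg hs0 hε) hsε
  set g := D.γ (n + 1)
  have hL := hD.L_pos x
  set w := D.L x ^ (D.α - 1) with hw
  have hw0 : 0 < w := by positivity
  have hwx : D.L x ^ D.α = w * D.L x := by
    rw [hw, ← Real.rpow_add_one hL.ne']; congr 1; ring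
  have hwx' : w * D.L x ^ (1 - D.α) = 1 := by
    rw [hw, ← Real.rpow_add hL]; simp
  have hκ : (D.L x ^ ((1 - D.α) / 2)) ^ 2 = D.L x ^ (1 - D.α) := by
    rw [← Real.rpow_natCast, ← Real.rpow_mul hL.le]
    congr 1; push_cast; ring
  let A : EuclideanSpace ℝ (Fin q) → ℝ := fun u =>
    -(g * D.α * w) * inner ℝ (gradient D.L x) (D.H x u - D.h x)
  set K := g * D.α * w * (Real.sqrt (D.CL * D.L x) * (D.Cα * D.L x ^ ((1 - D.α) / 2))) with hK
  have hK0 : 0 ≤ K := by positivity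
  have hK2 : K ^ 2 = g ^ 2 * D.α ^ 2 * D.CL * D.Cα ^ 2 * D.L x ^ D.α := by
    rw [hK, mul_pow, mul_pow (Real.sqrt _), Real.sq_sqrt (by positivity), mul_pow D.Cα, hκ, hwx]
    linear_combination (g ^ 2 * D.α ^ 2 * w * D.CL * D.L x * D.Cα ^ 2) * hwx'
  have hA : ∀ u v, |A u - A v| ≤ K * ‖u - v‖ := by
    intro u v
    have e : A u - A v = -(g * D.α * w) * inner ℝ (gradient D.L x) (D.H x u - D.H x v) := by
      simp only [A, ← mul_sub, ← inner_sub_right, sub_sub_sub_cancel_right]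
    have hnn : 0 ≤ g * D.α * w := by positivity
    rw [e, abs_mul, abs_neg, abs_of_nonneg hnn, hK, mul_assoc (g * D.α * w)]
    refine mul_le_mul_of_nonneg_left ?_ hnn
    refine (abs_real_inner_le_norm _ _).trans ?_
    rw [mul_assoc]
    exact mul_le_mul (Real.le_sqrt_of_sq_le (hD.norm_gradient_sq_le x)) (hD.norm_H_sub_le x u v)
      (norm_nonneg _) (Real.sqrt_nonneg _)
  have hA0 : ∫ u, A u ∂D.μ = 0 := by
    have hi : Integrable (fun u => D.H x u - D.h x) D.μ :=
      (hD.integrable_H x).sub (integrable_const _)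
    simp only [A]
    rw [integral_const_mul, integral_inner hi, integral_sub (hD.integrable_H x)
      (integrable_const _)]
    simp [h]
  have hAm : Measurable A := ((measurable_const.inner
    ((hD.measurable_H x).sub measurable_const))).const_mul _
  -- The doubled parameter prepares for Cauchy–Schwarz, which separates the centred term `A` from
  -- the term in `‖u‖²`. Together with `ρ² ≤ ρ` it gives the constant `β / 2` in `Π_2`.
  have h1 := hD.gc.expBound hK0 hA (s := 2 * ρ) (by positivity)
  rw [hA0, mul_zero, zero_add, hK2] at h1
  have h2 : ExpBound D.μ (fun u => 2 * ρ * (4 * D.η * D.α * D.Cα ^ 2 * g ^ 2) * ‖u‖ ^ 2)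
      (g ^ 2 * D.logMom (s * D.epsβ)) := by
    -- Jensen with exponent `γ²/G ≤ 1` puts the factor `γ²` in front of the logarithmic moment, so
    -- that these contributions add up to a multiple of `Γ_N`.
    have e1 := (hD.expBound_logMom hsε).const_mul (by fun_prop) (p := g ^ 2 / G)
      (by positivity) (by rw [div_le_one (by linarith)]; exact hG)
    refine (e1.mono fun u => ?_).mono_right ?_
    · rw [← mul_assoc (g ^ 2 / G)]
      refine mul_le_mul_of_nonneg_right ?_ (sq_nonneg _)
      rw [div_mul_eq_mul_div, le_div_iff₀ (by linarith)]
      have := mul_le_mul_of_nonneg_left hρ (sq_nonneg g)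
      linarith
    · refine mul_le_mul_of_nonneg_right ?_ hlm
      exact div_le_self (sq_nonneg g) hG1
  have h3 := (h1.convex_comb (by fun_prop) (by fun_prop) h2 (p := 1 / 2) (q := 1 / 2) (by norm_num)
    (by norm_num) (by norm_num)).add_const
    (ρ * ((1 + 2 * D.η * D.α * D.Ch * g ^ 2) * D.L x ^ D.α + D.Cbar * g ^ 2))
  refine (h3.mono fun u => ?_).mono_right ?_
  · have := mul_le_mul_of_nonneg_left (hD.L_step_rpow_le n x u) hρ0
    simp only [A]
    linarith
  · have e1 : ρ ^ 2 ≤ ρ := by nlinarith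
    have e2 : 0 ≤ D.β / 2 * (g ^ 2 * D.α ^ 2 * D.CL * D.Cα ^ 2 * D.L x ^ D.α) := by positivity
    have e3 := mul_le_mul_of_nonneg_right e1 e2
    linarith

theorem κ_nonneg (hD : D.Standing) :
    0 ≤ 2 * D.η * D.α * D.Ch + D.β / 2 * D.α ^ 2 * D.CL * D.Cα ^ 2 := by
  have hα := hD.α_pos
  have hη := hD.η_nonneg
  have hCα := hD.Cα_pos
  have hCL := hD.CL_pos
  have hβ := hD.β_pos
  have hCh := hD.Ch_pos
  positivity

theorem Pi2_succ (_hD : D.Standing) (n : ℕ) : D.Pi2 (n + 1) = D.Pi2 n *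
    (1 + (2 * D.η * D.α * D.Ch + D.β / 2 * D.α ^ 2 * D.CL * D.Cα ^ 2) * D.γ (n + 1) ^ 2) :=
  prod_range_succ _ _

theorem Pi2_mono (hD : D.Standing) : Monotone D.Pi2 := by
  have h1 : ∀ n, 0 ≤ D.Pi2 n := fun n => prod_nonneg fun k _ => by
    have := mul_nonneg hD.κ_nonneg (sq_nonneg (D.γ (k + 1))); linarith
  refine monotone_nat_of_le_succ fun n => ?_
  rw [hD.Pi2_succ]
  have := mul_nonneg (h1 n) (mul_nonneg hD.κ_nonneg (sq_nonneg (D.γ (n + 1))))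
  linarith

theorem one_le_Pi2 (hD : D.Standing) (n : ℕ) : 1 ≤ D.Pi2 n := by
  simpa [Pi2] using hD.Pi2_mono (Nat.zero_le n)

theorem Cbar_nonneg (hD : D.Standing) : 0 ≤ D.Cbar := by
  have hα := hD.α_pos
  have hη := hD.η_nonneg
  have hm := hD.m2_nonneg
  rw [Cbar]; positivity

/-- Exponential moments of the Lyapunov function along the scheme. -/
theorem expBound_law_L (hD : D.Standing) {s G : ℝ} (hs0 : 0 ≤ s) (hs1 : s ≤ 1) (hG1 : 1 ≤ G)
    (n : ℕ) : (∀ k < n, D.γ (k + 1) ^ 2 ≤ G) → ∀ ρ : ℝ, 0 ≤ ρ → ρ * D.Pi2 n ≤ 1 →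
    ρ * D.Pi2 n * (8 * D.η * D.α * D.Cα ^ 2 * G) ≤ s * D.epsβ →
    ExpBound (D.law n) (fun x => ρ * D.L x ^ D.α)
      (ρ * D.Pi2 n * (D.L D.θ₀ ^ D.α + D.Cbar * D.Gam2 n) +
        1 / 2 * D.Gam2 n * D.logMom (s * D.epsβ)) := by
  have hα := hD.α_pos
  have hη := hD.η_nonneg
  have hCα := hD.Cα_pos
  induction n with
  | zero =>
    intro _ ρ _ _ _
    have hm : Measurable fun x => ENNReal.ofReal (Real.exp (ρ * D.L x ^ D.α)) := by
      have := hD.continuous_L.measurable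
      fun_prop
    rw [ExpBound, law, lintegral_dirac' _ hm]
    simp [Pi2, Gam2]
  | succ n ih =>
    intro hγ ρ hρ0 hρ1 hρ2
    have hP := hD.one_le_Pi2 (n + 1)
    have hle : ρ ≤ ρ * D.Pi2 (n + 1) := by nlinarith
    have hB : 0 ≤ 8 * D.η * D.α * D.Cα ^ 2 * G := by positivity
    have h1 := hD.expBound_L_step (n := n) hs0 hs1 hG1 (hγ n n.lt_succ_self) hρ0 (hle.trans hρ1)
      ((mul_le_mul_of_nonneg_right hle hB).trans hρ2)
    have hm : Measurable fun x => ρ * D.L x ^ D.α := by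
      have := hD.continuous_L.measurable
      fun_prop
    refine hD.expBound_law_succ hm h1 ?_
    set κ := 1 + (2 * D.η * D.α * D.Ch + D.β / 2 * D.α ^ 2 * D.CL * D.Cα ^ 2) *
      D.γ (n + 1) ^ 2 with hκ
    have hκ0 : 0 ≤ κ := by
      have := mul_nonneg hD.κ_nonneg (sq_nonneg (D.γ (n + 1)))
      linarith
    -- Going back one step replaces `ρ` by `ρ κ`; the product with `Π_2` is unchanged, and so are
    -- both smallness conditions.
    have e : ρ * κ * D.Pi2 n = ρ * D.Pi2 (n + 1) := by rw [hD.Pi2_succ]; ring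
    have h2 := ih (fun k hk => hγ k (hk.trans n.lt_succ_self)) (ρ * κ) (by positivity)
      (by rw [e]; exact hρ1) (by rw [e]; exact hρ2)
    refine (h2.add_const _).mono_right ?_
    rw [e, Gam2, Gam2, sum_range_succ]
    have h3 := mul_le_mul_of_nonneg_right hle
      (mul_nonneg hD.Cbar_nonneg (sq_nonneg (D.γ (n + 1))))
    linarith

end Standing
end RMData

/-! ### Hölder weights and the backward recursion for Laplace transforms. -/

namespace RMData

variable {d q : ℕ} {D : RMData d q}

theorem one_le_wt (k : ℕ) : 1 ≤ wt k := by
  have h1 : 1 ≤ Real.log ((k : ℝ) + 4) := by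
    rw [Real.le_log_iff_exp_le (by positivity)]
    have := Real.exp_one_lt_three
    have : (0 : ℝ) ≤ k := k.cast_nonneg
    linarith
  have h2 : (1 : ℝ) ≤ (k : ℝ) + 1 := by
    have : (0 : ℝ) ≤ k := k.cast_nonneg
    linarith
  rw [wt]
  nlinarith [one_le_pow₀ h1 (n := 2)]

/-- The product of the Hölder exponents `1 + 1 / wt k`. -/
noncomputable def holderProd (n : ℕ) : ℝ := ∏ k ∈ range n, (1 + 1 / wt k)

theorem wt_pos (k : ℕ) : 0 < wt k := zero_lt_one.trans_le (one_le_wt k)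

theorem holderProd_succ (n : ℕ) : holderProd (n + 1) = holderProd n * (1 + 1 / wt n) :=
  prod_range_succ _ _

theorem holderProd_mono : Monotone holderProd := by
  have h0 : ∀ k, 0 ≤ 1 / wt k := fun k => by have := wt_pos k; positivity
  have h1 : ∀ n, 0 ≤ holderProd n := fun n => prod_nonneg fun k _ => by linarith [h0 k]
  refine monotone_nat_of_le_succ fun n => ?_
  rw [holderProd_succ]
  have := mul_nonneg (h1 n) (h0 n)
  linarith

theorem one_le_holderProd (n : ℕ) : 1 ≤ holderProd n := by
  simpa [holderProd] using holderProd_mono (Nat.zero_le n)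

theorem holderProd_pos (n : ℕ) : 0 < holderProd n := zero_lt_one.trans_le (one_le_holderProd n)

theorem holderProd_le_exp (n : ℕ) : holderProd n ≤ Real.exp (wtSum n) := by
  rw [wtSum, Real.exp_sum]
  refine prod_le_prod (fun k _ => ?_) fun k _ => ?_
  · have := wt_pos k; positivity
  · rw [add_comm]; exact Real.add_one_le_exp _

theorem holderProd_div_le_exp (n k : ℕ) : holderProd n / holderProd k ≤ Real.exp (wtSum n) :=
  (div_le_self (holderProd_pos n).le (one_le_holderProd k)).trans (holderProd_le_exp n)

/-- The exponent to which the Lyapunov function enters at time `k`, for the Laplace transform at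
`l` of a `K`-Lipschitz function of `θ_n`. -/
noncomputable def weight (D : RMData d q) (n k : ℕ) (l K : ℝ) : ℝ :=
  (1 + wt k) * l ^ 2 * (holderProd n / holderProd (k + 1)) ^ 2 * K ^ 2 *
    (D.β / 4 * D.Cα ^ 2 * D.γ (k + 1) ^ 2) * (D.Pi1 n / D.Pi1 (k + 1))

namespace Standing

/-- The conditional expectation operator preserves Lipschitz functions. -/
theorem abs_integral_step_sub_le (hD : D.Standing) (n : ℕ) {f : EuclideanSpace ℝ (Fin d) → ℝ}
    {K C : ℝ} (hK : 0 ≤ K) (hf : ∀ x y, |f x - f y| ≤ K * ‖x - y‖) (hm : Measurable f)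
    (hC : ∀ x, |f x| ≤ C) (x y) :
    |∫ u, f (D.step n x u) ∂D.μ - ∫ u, f (D.step n y u) ∂D.μ| ≤
      K * Real.sqrt (D.fac n) * ‖x - y‖ := by
  have := hD.prob
  have hi : ∀ x, Integrable (fun u => f (D.step n x u)) D.μ := fun x =>
    Integrable.of_bound (hm.comp ((hD.measurable_step n).comp
      measurable_prodMk_left)).aestronglyMeasurable C (.of_forall fun u => hC _)
  rw [← integral_sub (hi x) (hi y), mul_assoc]
  refine le_trans ?_ (mul_le_mul_of_nonneg_left (hD.integral_norm_step_sub_le n x y) hK)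
  rw [← integral_const_mul]
  have hg : Integrable (fun u => K * ‖D.step n x u - D.step n y u‖) D.μ :=
    ((hD.integrable_step n x).sub (hD.integrable_step n y)).norm.const_mul K
  exact norm_integral_le_of_norm_le
    (f := fun u => f (D.step n x u) - f (D.step n y u)) hg (.of_forall fun u => hf _ _)

/-- Integrating the last innovation leaves the conditional expectation `Tf` plus a cost proportional
to `L^(1-α)`. Hölder separates the two, and the induction hypothesis applies to `Tf` with `l`
enlarged by `1 + 1 / wt n` and `K` reduced by the contraction. Unrolling produces `weight` as the
coefficient at time `k`, and the product of the Hölder exponents as the divisor of `b k`. The bounds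
`b` are left free because the cases `α > 1/2` and `α = 1/2` supply them differently. -/
theorem expBound_law_of_lipschitz (hD : D.Standing) (n : ℕ) :
    ∀ (l K C : ℝ) (f : EuclideanSpace ℝ (Fin d) → ℝ) (b : ℕ → ℝ), 0 ≤ l → 0 ≤ K →
    (∀ x y, |f x - f y| ≤ K * ‖x - y‖) → Measurable f → (∀ x, |f x| ≤ C) →
    (∀ k < n, ExpBound (D.law k) (fun x => weight D n k l K * D.L x ^ (1 - D.α)) (b k)) →
    ExpBound (D.law n) (fun x => l * f x) (l * ∫ x, f x ∂D.law n +
      ∑ k ∈ range n, b k / ((1 + wt k) * (holderProd n / holderProd (k + 1)))) := by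
  induction n with
  | zero =>
    intro l K C f b hl hK hf hm hC hb
    have h1 : Measurable fun x => ENNReal.ofReal (Real.exp (l * f x)) := by fun_prop
    rw [ExpBound, law, lintegral_dirac' _ h1, integral_dirac' _ _ hm.stronglyMeasurable]
    simp
  | succ n ih =>
    intro l K C f b hl hK hf hm hC hb
    have := hD.prob
    have := hD.isProbabilityMeasure_law n
    have hCα := hD.Cα_pos
    have hγ := hD.γ_nonneg n
    have hfac := hD.fac_pos n
    have hw := wt_pos n
    set Tf : EuclideanSpace ℝ (Fin d) → ℝ := fun x => ∫ u, f (D.step n x u) ∂D.μ with hTf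
    set K' := K * Real.sqrt (D.fac n) with hK'
    have hK'0 : 0 ≤ K' := by positivity
    have hTlip : ∀ x y, |Tf x - Tf y| ≤ K' * ‖x - y‖ :=
      hD.abs_integral_step_sub_le n hK hf hm hC
    have hTm : Measurable Tf := by
      refine (LipschitzWith.of_dist_le_mul (K := ⟨K', hK'0⟩) fun x y => ?_).continuous.measurable
      rw [Real.dist_eq, dist_eq_norm]
      exact hTlip x y
    have hTC : ∀ x, |Tf x| ≤ C := fun x =>
      (norm_integral_le_of_norm_le_const (μ := D.μ)
        (f := fun u => f (D.step n x u)) (C := C) (.of_forall fun u => hC _)).trans_eq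
        (by rw [probReal_univ, mul_one])
    have hTint : ∫ x, Tf x ∂D.law n = ∫ x, f x ∂D.law (n + 1) := by
      rw [law, integral_map (hD.measurable_step n).aemeasurable hm.aestronglyMeasurable,
        integral_prod (fun z => f (Function.uncurry (D.step n) z)) (Integrable.of_bound (hm.comp
          (hD.measurable_step n)).aestronglyMeasurable C (.of_forall fun u => hC _))]
      rfl
    have hone : ∀ x, ExpBound D.μ (fun u => l * f (D.step n x u)) (l * Tf x +
        l ^ 2 * K ^ 2 * (D.β / 4 * D.Cα ^ 2 * D.γ (n + 1) ^ 2) * D.L x ^ (1 - D.α)) := by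
      intro x
      have hL := hD.L_pos x
      have h1 := hD.gc.expBound (g := fun u => f (D.step n x u))
        (K := K * (D.γ (n + 1) * D.Cα * D.L x ^ ((1 - D.α) / 2))) (by positivity)
        (fun u v => (hf _ _).trans (by
          rw [mul_assoc K]
          exact mul_le_mul_of_nonneg_left (hD.norm_step_sub_le n x u v) hK)) hl
      refine h1.mono_right (le_of_eq ?_)
      have h2 : (D.L x ^ ((1 - D.α) / 2)) ^ 2 = D.L x ^ (1 - D.α) := by
        rw [← Real.rpow_natCast, ← Real.rpow_mul hL.le]
        congr 1; push_cast; ring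
      rw [← h2]
      ring
    set p := 1 + 1 / wt n with hp
    have hp0 : 0 < p := by positivity
    have hPn := hD.Pi1_pos n
    have hHn := holderProd_pos n
    -- The new parameters of `Tf` leave the weights unchanged, so the same `b` serves at the
    -- previous time.
    have hweight : ∀ k, weight D n k (p * l) K' = weight D (n + 1) k l K := by
      intro k
      rw [weight, weight, holderProd_succ n, Pi1_succ D n, hK', mul_pow K, Real.sq_sqrt hfac.le]
      ring
    have h1 := ih (p * l) K' C Tf b (by positivity) hK'0 hTlip hTm hTC (fun k hk => by
      rw [hweight]; exact hb k (hk.trans n.lt_succ_self))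
    have h2 := hb n n.lt_succ_self
    have hLm := hD.continuous_L.measurable
    have h3 := h1.convex_comb (by fun_prop) (by fun_prop) h2 (p := 1 / p) (q := 1 / (1 + wt n))
      (by positivity) (by positivity) (by rw [hp]; field_simp; ring)
    refine hD.expBound_law_succ (by fun_prop) hone ((h3.mono fun x => ?_).mono_right ?_)
    · refine le_of_eq ?_
      have hH1 := holderProd_pos (n + 1)
      have hP1 := hD.Pi1_pos (n + 1)
      rw [weight, div_self hH1.ne', div_self hP1.ne']
      field_simp
    · refine le_of_eq ?_
      rw [sum_range_succ, hTint, div_self (holderProd_pos (n + 1)).ne', mul_add, mul_sum,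
        ← add_assoc]
      congr 1
      · congr 1
        · field_simp
        · refine sum_congr rfl fun k _ => ?_
          have := wt_pos k
          have := holderProd_pos (k + 1)
          rw [holderProd_succ n, ← hp]
          field_simp
      · rw [mul_one]; ring

theorem integrable_norm_law (hD : D.Standing) (n : ℕ) : Integrable (fun x => ‖x‖) (D.law n) := by
  have := hD.prob
  induction n with
  | zero => exact integrable_dirac (by simp)
  | succ n ih =>
    have := hD.isProbabilityMeasure_law n
    have hC := hD.hl.1
    have hγ := hD.γ_nonneg n
    rw [law, integrable_map_measure measurable_norm.aestronglyMeasurable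
      (hD.measurable_step n).aemeasurable]
    have h1 : Integrable (fun z : EuclideanSpace ℝ (Fin d) × EuclideanSpace ℝ (Fin q) => ‖z.1‖)
        ((D.law n).prod D.μ) := ih.comp_fst D.μ
    have h2 : Integrable (fun z : EuclideanSpace ℝ (Fin d) × EuclideanSpace ℝ (Fin q) =>
        ‖D.H 0 z.2‖) ((D.law n).prod D.μ) := (hD.integrable_H 0).norm.comp_snd (D.law n)
    have h3 : Integrable (fun z : EuclideanSpace ℝ (Fin d) × EuclideanSpace ℝ (Fin q) =>
        ‖z.1‖ * (1 + ‖z.2‖)) ((D.law n).prod D.μ) :=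
      ih.mul_prod ((integrable_const 1).add hD.gc.integrable_norm)
    refine (h1.add ((h2.add (h3.const_mul D.CH)).const_mul (D.γ (n + 1)))).mono'
      (hD.measurable_step n).norm.aestronglyMeasurable (.of_forall fun z => ?_)
    have h4 := hD.norm_H_sub_le' z.2 z.1 0
    have h5 := norm_sub_norm_le (D.H z.1 z.2) (D.H 0 z.2)
    rw [sub_zero] at h4
    have h6 : ‖D.H z.1 z.2‖ ≤ ‖D.H 0 z.2‖ + D.CH * (‖z.1‖ * (1 + ‖z.2‖)) := by nlinarith
    simp only [Function.comp_apply, Function.uncurry, step, norm_norm, Pi.add_apply]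
    refine (norm_sub_le _ _).trans ?_
    rw [norm_smul, Real.norm_eq_abs, abs_of_nonneg hγ]
    gcongr

end Standing
end RMData

/-! ### Scalar inequalities for `α > 1/2`. -/

/-- Estimate of one summand of the Laplace bound, with `a = α/(2α-1)`. The factor `(1 + w) R` is
kept apart to cancel the Hölder divisor. The remaining `(1 + w)^(a-1)` costs `2^(a-1)`, `π'^a` costs
`2^a`, and `R^(2a-1)` costs `exp((2a-1) S)`. -/
theorem max_rpow_le_mul_add {a w R ρ B g π π' S : ℝ} (ha : 1 ≤ a) (hw : 1 ≤ w) (hR : 0 < R)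
    (hRS : R ≤ Real.exp S) (hS : 0 ≤ S) (hπ : 0 ≤ π) (hπ0 : 0 ≤ π') (hπ' : π' ≤ 2 * π)
    (hg : 0 ≤ g) (hB : 0 ≤ B) (hρ : 0 ≤ ρ) :
    max ((1 + w) * ρ ^ 2 * R ^ 2 * (B * g ^ 2) * π')
      (((1 + w) * ρ ^ 2 * R ^ 2 * (B * g ^ 2) * π') ^ a) ≤
    (2 : ℝ) ^ (2 * a - 1) * Real.exp ((2 * a - 1) * S) * max B (B ^ a) *
      (g ^ 2 * π * ρ ^ 2 + g ^ (2 * a) * π ^ a * w ^ (a - 1) * ρ ^ (2 * a)) * ((1 + w) * R) := by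
  have hw0 : 0 < w := by linarith
  have h2 : (2 : ℝ) ≤ 2 ^ (2 * a - 1) := by
    simpa using Real.rpow_le_rpow_of_exponent_le (one_le_two (α := ℝ))
      (by linarith : 1 ≤ 2 * a - 1)
  have hRF : R ≤ Real.exp ((2 * a - 1) * S) :=
    hRS.trans (Real.exp_le_exp.2 (by nlinarith))
  have hX : 0 ≤ g ^ 2 * π * ρ ^ 2 := by positivity
  have hY : 0 ≤ g ^ (2 * a) * π ^ a * w ^ (a - 1) * ρ ^ (2 * a) := by positivity
  have hM : 0 ≤ max B (B ^ a) := hB.trans (le_max_left _ _)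
  refine max_le ?_ ?_
  · calc (1 + w) * ρ ^ 2 * R ^ 2 * (B * g ^ 2) * π'
        = π' * R * B * (g ^ 2 * ρ ^ 2) * ((1 + w) * R) := by ring
      _ ≤ (2 ^ (2 * a - 1) * π) * Real.exp ((2 * a - 1) * S) * max B (B ^ a) * (g ^ 2 * ρ ^ 2) *
          ((1 + w) * R) := by
          gcongr
          · exact hπ'.trans (mul_le_mul_of_nonneg_right h2 hπ)
          · exact le_max_left _ _
      _ = (2 : ℝ) ^ (2 * a - 1) * Real.exp ((2 * a - 1) * S) * max B (B ^ a) *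
          (g ^ 2 * π * ρ ^ 2) * ((1 + w) * R) := by ring
      _ ≤ _ := by
          gcongr
          linarith
  · have e1 : (1 + w) ^ a = (1 + w) * (1 + w) ^ (a - 1) := by
      rw [Real.rpow_sub_one (by positivity)]; field_simp
    have e2 : ∀ z : ℝ, 0 ≤ z → (z ^ 2) ^ a = z ^ (2 * a) := fun z hz => by
      rw [← Real.rpow_natCast, ← Real.rpow_mul hz]; norm_num
    have e3 : R ^ (2 * a) = R * R ^ (2 * a - 1) := by
      rw [Real.rpow_sub_one hR.ne']; field_simp
    have e4 : (2 : ℝ) ^ (a - 1) * 2 ^ a = 2 ^ (2 * a - 1) := by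
      rw [← Real.rpow_add two_pos]; congr 1; ring
    have h3 : (1 + w) ^ (a - 1) ≤ 2 ^ (a - 1) * w ^ (a - 1) := by
      rw [← Real.mul_rpow two_pos.le hw0.le]
      exact Real.rpow_le_rpow (by positivity) (by linarith) (by linarith)
    have h4 : π' ^ a ≤ 2 ^ a * π ^ a := by
      rw [← Real.mul_rpow two_pos.le hπ]
      exact Real.rpow_le_rpow hπ0 hπ' (by linarith)
    have h5 : R ^ (2 * a - 1) ≤ Real.exp ((2 * a - 1) * S) := by
      have h := Real.rpow_le_rpow hR.le hRS (by linarith : 0 ≤ 2 * a - 1)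
      rwa [← Real.exp_mul, mul_comm S] at h
    rw [Real.mul_rpow (by positivity) hπ0, Real.mul_rpow (by positivity) (by positivity),
      Real.mul_rpow (by positivity) (by positivity), Real.mul_rpow (by positivity) (by positivity),
      Real.mul_rpow hB (by positivity), e1, e2 ρ hρ, e2 R hR.le, e2 g hg, e3]
    calc (1 + w) * (1 + w) ^ (a - 1) * ρ ^ (2 * a) * (R * R ^ (2 * a - 1)) *
          (B ^ a * g ^ (2 * a)) * π' ^ a
        = (1 + w) ^ (a - 1) * π' ^ a * R ^ (2 * a - 1) * B ^ a * (ρ ^ (2 * a) * g ^ (2 * a)) *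
          ((1 + w) * R) := by ring
      _ ≤ (2 ^ (a - 1) * w ^ (a - 1)) * (2 ^ a * π ^ a) * Real.exp ((2 * a - 1) * S) *
          max B (B ^ a) * (ρ ^ (2 * a) * g ^ (2 * a)) * ((1 + w) * R) := by
          gcongr
          exact le_max_right _ _
      _ = (2 ^ (a - 1) * 2 ^ a) * Real.exp ((2 * a - 1) * S) * max B (B ^ a) *
          (g ^ (2 * a) * π ^ a * w ^ (a - 1) * ρ ^ (2 * a)) * ((1 + w) * R) := by ring
      _ ≤ _ := by
          rw [e4]
          gcongr
          linarith

/-- Young's inequality in the form used to compare two powers of the Lyapunov function. -/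
theorem mul_rpow_one_sub_le {t x r α : ℝ} (ht : 0 ≤ t) (hx : 0 < x) (hr : 0 < r)
    (hα : 1 / 2 < α) (hα1 : α ≤ 1) :
    t * x ^ (1 - α) ≤ t ^ (α / (2 * α - 1)) * ((2 * α - 1) / α * r ^ (-((1 - α) / (2 * α - 1)))) +
      (1 - α) / α * r * x ^ α := by
  have h1 : 0 < 2 * α - 1 := by linarith
  have h2 : 0 < α := by linarith
  -- In weighted form the inequality includes `α = 1`, where the second weight is zero. The powers
  -- of `r` cancel in the geometric mean.
  have h := Real.geom_mean_le_arith_mean2_weighted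
    (w₁ := (2 * α - 1) / α) (w₂ := (1 - α) / α)
    (p₁ := t ^ (α / (2 * α - 1)) * r ^ (-((1 - α) / (2 * α - 1)))) (p₂ := r * x ^ α)
    (by positivity) (div_nonneg (by linarith) h2.le) (by positivity) (by positivity)
    (by field_simp; ring)
  have e : (t ^ (α / (2 * α - 1)) * r ^ (-((1 - α) / (2 * α - 1)))) ^ ((2 * α - 1) / α) *
      (r * x ^ α) ^ ((1 - α) / α) = t * x ^ (1 - α) := by
    rw [Real.mul_rpow (by positivity) (by positivity), Real.mul_rpow hr.le (by positivity),
      ← Real.rpow_mul ht, ← Real.rpow_mul hr.le, ← Real.rpow_mul hx.le]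
    have e1 : α / (2 * α - 1) * ((2 * α - 1) / α) = 1 := by
      generalize 2 * α - 1 = c at h1 ⊢
      field_simp
    have e2 : -((1 - α) / (2 * α - 1)) * ((2 * α - 1) / α) = -((1 - α) / α) := by
      generalize 2 * α - 1 = c at h1 ⊢
      field_simp
    have e3 : α * ((1 - α) / α) = 1 - α := by field_simp
    rw [e1, e2, e3, Real.rpow_one, Real.rpow_neg hr.le]
    have : r ^ ((1 - α) / α) ≠ 0 := by positivity
    field_simp
  rw [e] at h
  linarith

/-! ### Explicit constants and the Laplace bounds by `Φ_{α,N}`. -/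

namespace RMData

variable {d q : ℕ} {D : RMData d q}

theorem one_le_stepMax (D : RMData d q) (N : ℕ) : 1 ≤ D.stepMax N := le_max_left _ _

theorem sq_le_stepMax (D : RMData d q) {k N : ℕ} (hk : k < N) : D.γ (k + 1) ^ 2 ≤ D.stepMax N :=
  le_max_of_le_right
    (le_ciSup (f := fun k : Fin N => D.γ (k + 1) ^ 2) (Set.finite_range _).bddAbove ⟨k, hk⟩)

theorem Gam2_mono (D : RMData d q) : Monotone D.Gam2 := fun _ _ hmn =>
  sum_le_sum_of_subset_of_nonneg (range_mono hmn) fun _ _ _ => sq_nonneg _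

theorem Gam2_nonneg (D : RMData d q) (n : ℕ) : 0 ≤ D.Gam2 n := sum_nonneg fun _ _ => sq_nonneg _

theorem wtSum_nonneg (n : ℕ) : 0 ≤ wtSum n := sum_nonneg fun k _ => by
  have := wt_pos k; positivity

theorem le_sTilde (D : RMData d q) {k N : ℕ} (hk : k < N) :
    Real.sqrt ((k : ℝ) + 1) * Real.log ((k : ℝ) + 4) * D.γ (k + 1) *
      Real.sqrt (D.Pi1 N / D.Pi1 k) * Real.exp (wtSum N) ≤ D.sTilde N :=
  le_ciSup (f := fun k : Fin N => Real.sqrt ((k : ℝ) + 1) * Real.log ((k : ℝ) + 4) * D.γ (k + 1) *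
    Real.sqrt (D.Pi1 N / D.Pi1 k) * Real.exp (wtSum N)) (Set.finite_range _).bddAbove ⟨k, hk⟩

theorem log_add_four_nonneg (k : ℕ) : 0 ≤ Real.log ((k : ℝ) + 4) :=
  Real.log_nonneg (by linarith [(k.cast_nonneg : (0 : ℝ) ≤ k)])

namespace Standing

theorem epsβ_pos (hD : D.Standing) : 0 < D.epsβ := by
  have := hD.β_pos; rw [epsβ]; positivity

theorem LamN_denom_pos (hD : D.Standing) (N : ℕ) :
    0 < 8 * D.η * D.α * D.Cα ^ 2 * D.stepMax N := by
  have := hD.η_pos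
  have := hD.α_pos
  have := hD.Cα_pos
  have := zero_lt_one.trans_le (D.one_le_stepMax N)
  positivity

theorem LamN_mul_Pi2 (hD : D.Standing) (N : ℕ) : D.LamN N * D.Pi2 N =
    min 1 (D.epsβ / (8 * D.η * D.α * D.Cα ^ 2 * D.stepMax N)) :=
  div_mul_cancel₀ _ (zero_lt_one.trans_le (hD.one_le_Pi2 N)).ne'

theorem LamN_pos (hD : D.Standing) (N : ℕ) : 0 < D.LamN N :=
  div_pos (lt_min one_pos (div_pos hD.epsβ_pos (hD.LamN_denom_pos N)))
    (zero_lt_one.trans_le (hD.one_le_Pi2 N))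

theorem lyapunov_bound_nonneg (hD : D.Standing) (n : ℕ) :
    0 ≤ D.L D.θ₀ ^ D.α + D.Cbar * D.Gam2 n :=
  add_nonneg (Real.rpow_nonneg (hD.L_pos _).le _) (mul_nonneg hD.Cbar_nonneg (D.Gam2_nonneg n))

/-- `Λ_N` is chosen so that both smallness conditions of `expBound_law_L` hold at every time up to
`N`; monotonicity makes the bound uniform in `k`. The scaling `s` lets the logarithmic moment be
taken at `s ε_β`. -/
theorem expBound_law_LamN (hD : D.Standing) {s : ℝ} (hs0 : 0 ≤ s) (hs1 : s ≤ 1) {k N : ℕ}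
    (hk : k ≤ N) :
    ExpBound (D.law k) (fun x => s * D.LamN N * D.L x ^ D.α)
      (s * D.LamN N * D.Pi2 N * (D.L D.θ₀ ^ D.α + D.Cbar * D.Gam2 N) +
        1 / 2 * D.Gam2 N * D.logMom (s * D.epsβ)) := by
  have hΛ := hD.LamN_pos N
  have hP := hD.one_le_Pi2 k
  have hPk : D.LamN N * D.Pi2 k ≤ D.LamN N * D.Pi2 N :=
    mul_le_mul_of_nonneg_left (hD.Pi2_mono hk) hΛ.le
  rw [hD.LamN_mul_Pi2] at hPk
  have h1 : D.LamN N * D.Pi2 k ≤ 1 := hPk.trans (min_le_left _ _)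
  have h2 := (le_div_iff₀ (hD.LamN_denom_pos N)).1 (hPk.trans (min_le_right _ _))
  have hsε : s * D.epsβ ≤ D.epsβ := mul_le_of_le_one_left hD.epsβ_pos.le hs1
  have hlm := hD.logMom_nonneg (mul_nonneg hs0 hD.epsβ_pos.le) hsε
  have h0 : 0 ≤ D.LamN N * D.Pi2 k := by positivity
  have h3 := hD.expBound_law_L hs0 hs1 (D.one_le_stepMax N) k
    (fun j hj => D.sq_le_stepMax (hj.trans_le hk)) (s * D.LamN N) (by positivity)
    (by rw [mul_assoc]; nlinarith) (by
      rw [mul_assoc s, mul_assoc s]; exact mul_le_mul_of_nonneg_left h2 hs0)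
  refine h3.mono_right ?_
  have h4 := hD.lyapunov_bound_nonneg k
  have h5 := hD.Cbar_nonneg
  have h6 := D.Gam2_mono hk
  have h7 := hD.Pi2_mono hk
  have h8 := zero_le_one.trans (hD.one_le_Pi2 N)
  gcongr

theorem PsiN_pos (hD : D.Standing) (hα : 1 / 2 < D.α) (N : ℕ) : 0 < D.PsiN N := by
  have h1 := hD.LamN_pos N
  have h2 := hD.lyapunov_bound_nonneg N
  have h3 := zero_lt_one.trans_le (hD.one_le_Pi2 N)
  have h4 := D.Gam2_nonneg N
  have h5 := hD.α_pos
  have h6 : 0 ≤ 1 - D.α := by linarith [hD.α_mem.2]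
  have h7 : 0 < 2 * D.α - 1 := by linarith
  have h8 := hD.epsβ_pos
  have hlm : 0 ≤ D.logMom (D.epsβ * (1 - D.α) / (2 * D.α)) := by
    refine hD.logMom_nonneg (by positivity) ?_
    rw [div_le_iff₀ (by positivity)]
    nlinarith
  have hr : 0 < D.rhoBar N := by rw [rhoBar]; positivity
  have h9 : 0 < (2 * D.α - 1) / D.α * D.rhoBar N ^ (-((1 - D.α) / (2 * D.α - 1))) := by positivity
  rw [PsiN]
  have h10 : 0 ≤ (1 - D.α) / D.α := by positivity
  have h11 : 0 ≤ (D.L D.θ₀ ^ D.α + D.Cbar * D.Gam2 N) * D.Pi2 N * D.rhoBar N *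
    ((1 - D.α) / D.α) := mul_nonneg (mul_nonneg (mul_nonneg h2 h3.le) hr.le) h10
  have h12 := mul_nonneg (mul_nonneg (by norm_num : (0 : ℝ) ≤ 1 / 2) h4) hlm
  linarith

/-- Young's inequality at `r = ρ̄_N` leaves `L^α` with coefficient `s Λ_N`, `s = (1-α)/(2α)`, which
explains the argument of the logarithmic moment in `Ψ`. The resulting bound `t^a c₁ + c₂` need not
vanish with `t`, so for `t ≤ 1` Jensen's inequality is applied to the case `t = 1` instead. The two
regimes are the origin of the maximum in `Φ`. -/
theorem expBound_law_rpow (hD : D.Standing) (hα : 1 / 2 < D.α) {k N : ℕ} (hk : k ≤ N) {t : ℝ}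
    (ht : 0 ≤ t) :
    ExpBound (D.law k) (fun x => t * D.L x ^ (1 - D.α))
      (D.PsiN N * max t (t ^ (D.α / (2 * D.α - 1)))) := by
  have := hD.isProbabilityMeasure_law k
  have hα0 := hD.α_pos
  have hα1 := hD.α_mem.2
  have hΛ := hD.LamN_pos N
  have hr : 0 < D.rhoBar N := by rw [rhoBar]; positivity
  have h2α : 0 < 2 * D.α - 1 := by linarith
  have hLm := hD.continuous_L.measurable
  set a := D.α / (2 * D.α - 1) with ha
  have ha1 : 1 ≤ a := by rw [ha, le_div_iff₀ h2α]; linarith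
  set c₁ := (2 * D.α - 1) / D.α * D.rhoBar N ^ (-((1 - D.α) / (2 * D.α - 1))) with hc₁
  set c₂ := (D.L D.θ₀ ^ D.α + D.Cbar * D.Gam2 N) * D.Pi2 N * D.rhoBar N * ((1 - D.α) / D.α) +
    1 / 2 * D.Gam2 N * D.logMom (D.epsβ * (1 - D.α) / (2 * D.α)) with hc₂
  have hΨ : D.PsiN N = c₁ + c₂ := by rw [PsiN, hc₁, hc₂]; ring
  have hc₂0 : 0 ≤ c₂ := by
    have h3 := zero_lt_one.trans_le (hD.one_le_Pi2 N)
    have h8 := hD.epsβ_pos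
    have hlm : 0 ≤ D.logMom (D.epsβ * (1 - D.α) / (2 * D.α)) := by
      refine hD.logMom_nonneg (div_nonneg (mul_nonneg h8.le (by linarith)) (by positivity)) ?_
      rw [div_le_iff₀ (by positivity)]
      nlinarith
    have h4 := D.Gam2_nonneg N
    have h10 : 0 ≤ (1 - D.α) / D.α := div_nonneg (by linarith) hα0.le
    exact add_nonneg (mul_nonneg (mul_nonneg (mul_nonneg (hD.lyapunov_bound_nonneg N) h3.le)
      hr.le) h10) (by positivity)
  have hbase : ∀ t : ℝ, 0 ≤ t →
      ExpBound (D.law k) (fun x => t * D.L x ^ (1 - D.α)) (t ^ a * c₁ + c₂) := by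
    intro t ht
    have h1 := hD.expBound_law_LamN (s := (1 - D.α) / (2 * D.α))
      (div_nonneg (by linarith) (by positivity))
      (by rw [div_le_one (by positivity)]; linarith) hk
    refine ((h1.add_const (t ^ a * c₁)).mono fun x => ?_).mono_right ?_
    · have := mul_rpow_one_sub_le ht (hD.L_pos x) hr hα hα1
      have e : (1 - D.α) / D.α * D.rhoBar N = (1 - D.α) / (2 * D.α) * D.LamN N := by
        rw [rhoBar]; field_simp
      rw [e] at this
      linarith
    · refine le_of_eq ?_
      have e1 : (1 - D.α) / (2 * D.α) * D.epsβ = D.epsβ * (1 - D.α) / (2 * D.α) := by ring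
      rw [hc₂, e1, rhoBar]
      field_simp
      ring
  rcases le_total 1 t with h1 | h1
  · refine (hbase t ht).mono_right ?_
    have h2 : 1 ≤ t ^ a := Real.one_le_rpow h1 (by linarith)
    have hΨ0 := (hD.PsiN_pos hα N).le
    calc t ^ a * c₁ + c₂ ≤ t ^ a * c₁ + t ^ a * c₂ := by nlinarith
      _ = D.PsiN N * t ^ a := by rw [hΨ]; ring
      _ ≤ _ := by gcongr; exact le_max_right _ _
  · have h2 := hbase 1 zero_le_one
    simp only [Real.one_rpow, one_mul, ← hΨ] at h2
    refine (h2.const_mul (by fun_prop) ht h1).mono_right ?_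
    rw [mul_comm]
    have hΨ0 := (hD.PsiN_pos hα N).le
    gcongr
    exact le_max_left _ _

theorem Pi1_div_nonneg (hD : D.Standing) (n k : ℕ) : 0 ≤ D.Pi1 n / D.Pi1 k :=
  div_nonneg (hD.Pi1_pos n).le (hD.Pi1_pos k).le

/-- The recursion produces `Π_{1,k+1}` while the rates contain `Π_{1,k}`; by `half_le_fac` the shift
costs a factor 2. -/
theorem Pi1_div_succ_le (hD : D.Standing) (n k : ℕ) :
    D.Pi1 n / D.Pi1 (k + 1) ≤ 2 * (D.Pi1 n / D.Pi1 k) := by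
  have h1 := hD.Pi1_pos n
  have h2 := hD.Pi1_pos k
  have h3 := hD.fac_pos k
  have h4 := hD.half_le_fac k
  rw [Pi1_succ, div_le_iff₀ (by positivity)]
  have : 2 * (D.Pi1 n / D.Pi1 k) * (D.Pi1 k * D.fac k) = D.Pi1 n * (2 * D.fac k) := by
    field_simp
  rw [this]
  nlinarith

theorem weight_nonneg (hD : D.Standing) (n k : ℕ) (l K : ℝ) : 0 ≤ weight D n k l K := by
  have h1 := wt_pos k
  have h2 := hD.Pi1_div_nonneg n (k + 1)
  have h3 := hD.β_pos
  rw [weight]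
  positivity

theorem expBound_law_Phi (hD : D.Standing) (hα : 1 / 2 < D.α) (N : ℕ) {ρ : ℝ} (hρ : 0 ≤ ρ)
    {f : EuclideanSpace ℝ (Fin d) → ℝ} (hf : LipschitzWith 1 f) {C : ℝ} (hC : ∀ x, |f x| ≤ C) :
    ExpBound (D.law N) (fun x => ρ * f x) (ρ * ∫ x, f x ∂D.law N +
      D.phiConst N * max (D.rateC N * ρ ^ 2) (D.rateCα N * ρ ^ (2 * D.α / (2 * D.α - 1)))) := by
  have h2α : 0 < 2 * D.α - 1 := by linarith
  have hα0 := hD.α_pos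
  have hα1 := hD.α_mem.2
  have hΨ := hD.PsiN_pos hα N
  have hβ := hD.β_pos
  have h := hD.expBound_law_of_lipschitz N ρ 1 C f
    (fun k => D.PsiN N * max (weight D N k ρ 1) (weight D N k ρ 1 ^ (D.α / (2 * D.α - 1))))
    hρ zero_le_one (fun x y => by simpa [Real.dist_eq, dist_eq_norm] using hf.dist_le_mul x y)
    hf.continuous.measurable hC
    (fun k hk => hD.expBound_law_rpow hα hk.le (hD.weight_nonneg N k ρ 1))
  refine h.mono_right (add_le_add_right ?_ _)
  set a := D.α / (2 * D.α - 1) with ha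
  have ha1 : 1 ≤ a := by rw [ha, le_div_iff₀ h2α]; linarith
  have e1 : 2 * D.α / (2 * D.α - 1) = 2 * a := by rw [ha]; ring
  have e2 : (1 - D.α) / (2 * D.α - 1) = a - 1 := by
    rw [ha, div_sub_one h2α.ne']; congr 1; ring
  have e3 : 1 / (2 * D.α - 1) = 2 * a - 1 := by
    rw [← e1, div_sub_one h2α.ne']; congr 1; ring
  set B := D.β * D.Cα ^ 2 / 4 with hB
  set c := (2 : ℝ) ^ (2 * a - 1) * Real.exp ((2 * a - 1) * wtSum N) * max B (B ^ a) with hc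
  have hB0 : 0 ≤ B := by positivity
  have hc0 : 0 ≤ c := mul_nonneg (by positivity) (hB0.trans (le_max_left _ _))
  have hterm : ∀ k ∈ range N, D.PsiN N * max (weight D N k ρ 1) (weight D N k ρ 1 ^ a) /
      ((1 + wt k) * (holderProd N / holderProd (k + 1))) ≤ D.PsiN N * (c *
        (D.γ (k + 1) ^ 2 * (D.Pi1 N / D.Pi1 k) * ρ ^ 2 +
          D.γ (k + 1) ^ (2 * a) * (D.Pi1 N / D.Pi1 k) ^ a * wt k ^ (a - 1) * ρ ^ (2 * a))) := by
    intro k _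
    have hw := wt_pos k
    have hR : 0 < holderProd N / holderProd (k + 1) :=
      div_pos (holderProd_pos N) (holderProd_pos (k + 1))
    have h1 := max_rpow_le_mul_add ha1 (one_le_wt k) hR (holderProd_div_le_exp N (k + 1))
      (wtSum_nonneg N) (hD.Pi1_div_nonneg N k) (hD.Pi1_div_nonneg N (k + 1))
      (hD.Pi1_div_succ_le N k) (hD.γ_nonneg k) hB0 hρ
    have e : weight D N k ρ 1 = (1 + wt k) * ρ ^ 2 * (holderProd N / holderProd (k + 1)) ^ 2 *
        (B * D.γ (k + 1) ^ 2) * (D.Pi1 N / D.Pi1 (k + 1)) := by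
      rw [weight, hB]; ring
    rw [e, mul_div_assoc]
    refine mul_le_mul_of_nonneg_left ?_ hΨ.le
    rw [div_le_iff₀ (by positivity)]
    exact h1
  refine (sum_le_sum hterm).trans ?_
  rw [← mul_sum, ← mul_sum, sum_add_distrib, ← sum_mul, ← sum_mul]
  have hX : ∑ k ∈ range N, D.γ (k + 1) ^ 2 * (D.Pi1 N / D.Pi1 k) = D.rateC N := rfl
  have hY : ∑ k ∈ range N, D.γ (k + 1) ^ (2 * a) * (D.Pi1 N / D.Pi1 k) ^ a * wt k ^ (a - 1) =
      D.rateCα N := by rw [rateCα, e1, e2]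
  rw [hX, hY, phiConst, e1, e3, ← ha, ← hB]
  set m := max (D.rateC N * ρ ^ 2) (D.rateCα N * ρ ^ (2 * a)) with hm
  have hm0 : 0 ≤ m := le_max_of_le_left (mul_nonneg (sum_nonneg fun k _ =>
    mul_nonneg (sq_nonneg _) (hD.Pi1_div_nonneg N k)) (sq_nonneg ρ))
  have h2 : (2 : ℝ) ^ (2 * a) = 2 * 2 ^ (2 * a - 1) := by
    rw [Real.rpow_sub_one two_ne_zero]; ring
  -- `Ψ ≤ exp Ψ`, and passing from a sum to twice a maximum raises `2^(2a-1)` to `2^(2a)`.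
  calc D.PsiN N * (c * (D.rateC N * ρ ^ 2 + D.rateCα N * ρ ^ (2 * a)))
      ≤ Real.exp (D.PsiN N) * (c * (m + m)) := by
        have h3 : D.PsiN N ≤ Real.exp (D.PsiN N) := by linarith [Real.add_one_le_exp (D.PsiN N)]
        have h4 : D.rateC N * ρ ^ 2 + D.rateCα N * ρ ^ (2 * a) ≤ m + m :=
          add_le_add (le_max_left _ _) (le_max_right _ _)
        refine (mul_le_mul_of_nonneg_left (mul_le_mul_of_nonneg_left h4 hc0) hΨ.le).trans ?_
        exact mul_le_mul_of_nonneg_right h3 (mul_nonneg hc0 (by linarith))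
    _ = _ := by rw [hc, h2]; ring

theorem lamStar_pos (hD : D.Standing) (N : ℕ) : 0 < D.lamStar N := by
  have := hD.LamN_pos N
  have := hD.β_pos
  have := hD.Cα_pos
  rw [lamStar]
  positivity

theorem lamStar_sq (hD : D.Standing) (N : ℕ) :
    D.lamStar N ^ 2 * (D.β * D.Cα ^ 2) = D.LamN N := by
  have h1 := hD.LamN_pos N
  have h2 := hD.β_pos
  have h3 := hD.Cα_pos
  rw [lamStar, Real.sq_sqrt (by positivity)]
  field_simp

theorem sTilde_nonneg (hD : D.Standing) (N : ℕ) : 0 ≤ D.sTilde N :=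
  Real.iSup_nonneg fun k => by
    have := log_add_four_nonneg (k : ℕ)
    have := hD.γ_nonneg k
    positivity

/-- With `1 + wt k ≤ 2 wt k` and the factor 2 of `Pi1_div_succ_le`, `β/4` becomes `β`, and the
weight is at most `(ρ s̃_N)² β C_α²`; `λ_*` is the threshold at which this equals `Λ_N`. -/
theorem weight_le_LamN (hD : D.Standing) {k N : ℕ} (hk : k < N) {ρ : ℝ} (hρ : 0 ≤ ρ)
    (h : ρ * D.sTilde N < D.lamStar N) : weight D N k ρ 1 ≤ D.LamN N := by
  have hl := hD.lamStar_pos N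
  have hlog := log_add_four_nonneg k
  have hγ := hD.γ_nonneg k
  have hP := hD.Pi1_div_nonneg N k
  have hw := one_le_wt k
  have hβ := hD.β_pos
  have hH : 0 < holderProd N / holderProd (k + 1) :=
    div_pos (holderProd_pos N) (holderProd_pos (k + 1))
  set z := Real.sqrt ((k : ℝ) + 1) * Real.log ((k : ℝ) + 4) * D.γ (k + 1) *
      Real.sqrt (D.Pi1 N / D.Pi1 k) * Real.exp (wtSum N) with hz
  have hz0 : 0 ≤ z := by positivity
  have hz2 : z ^ 2 = wt k * D.γ (k + 1) ^ 2 * (D.Pi1 N / D.Pi1 k) * Real.exp (wtSum N) ^ 2 := by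
    rw [hz, mul_pow, mul_pow, mul_pow, mul_pow, Real.sq_sqrt (by positivity), Real.sq_sqrt hP, wt]
  have h1 : (ρ * z) ^ 2 ≤ D.lamStar N ^ 2 := by
    have : ρ * z ≤ D.lamStar N := (mul_le_mul_of_nonneg_left (D.le_sTilde hk) hρ).trans h.le
    gcongr
  have h2 : weight D N k ρ 1 ≤ (2 * wt k) * ρ ^ 2 * Real.exp (wtSum N) ^ 2 * 1 ^ 2 *
      (D.β / 4 * D.Cα ^ 2 * D.γ (k + 1) ^ 2) * (2 * (D.Pi1 N / D.Pi1 k)) := by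
    have := hD.Pi1_div_nonneg N (k + 1)
    rw [weight]
    gcongr
    · linarith
    · exact holderProd_div_le_exp N (k + 1)
    · exact hD.Pi1_div_succ_le N k
  calc weight D N k ρ 1 ≤ _ := h2
    _ = (ρ * z) ^ 2 * (D.β * D.Cα ^ 2) := by rw [mul_pow, hz2]; ring
    _ ≤ D.lamStar N ^ 2 * (D.β * D.Cα ^ 2) := by gcongr
    _ = D.LamN N := hD.lamStar_sq N

/-- Here `L^(1-α)` and `L^α` coincide, so Jensen with exponent `weight / Λ_N ≤ 1` replaces Young's
inequality. -/
theorem expBound_law_PhiHalf (hD : D.Standing) (hα : D.α = 1 / 2) (N : ℕ) {ρ : ℝ} (hρ : 0 ≤ ρ)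
    (hρN : ρ * D.sTilde N < D.lamStar N)
    {f : EuclideanSpace ℝ (Fin d) → ℝ} (hf : LipschitzWith 1 f) {C : ℝ} (hC : ∀ x, |f x| ≤ C) :
    ExpBound (D.law N) (fun x => ρ * f x) (ρ * ∫ x, f x ∂D.law N +
      2 * D.phiConstHalf N * D.rateC N *
        ((ρ / D.lamStar N) ^ 2 / (1 - ρ * D.sTilde N / D.lamStar N))) := by
  have hl := hD.lamStar_pos N
  have hΛ := hD.LamN_pos N
  have hβ := hD.β_pos
  have hCα := hD.Cα_pos
  have hLm := hD.continuous_L.measurable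
  set M := D.LamN N * D.Pi2 N * (D.L D.θ₀ ^ (1 / 2 : ℝ) + D.Cbar * D.Gam2 N) +
      1 / 2 * D.Gam2 N * D.logMom D.epsβ with hM
  have hM0 : 0 ≤ M := by
    have h1 := hD.lyapunov_bound_nonneg N
    rw [hα] at h1
    have h2 := zero_lt_one.trans_le (hD.one_le_Pi2 N)
    have h3 := hD.logMom_nonneg hD.epsβ_pos.le le_rfl
    have h4 := D.Gam2_nonneg N
    exact add_nonneg (mul_nonneg (by positivity) h1) (by positivity)
  have hmom : ∀ k ≤ N, ExpBound (D.law k) (fun x => D.LamN N * D.L x ^ (1 - D.α)) M := by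
    intro k hk
    have h1 := hD.expBound_law_LamN zero_le_one le_rfl hk
    simp only [one_mul, hα] at h1
    simpa only [hα, show (1 : ℝ) - 1 / 2 = 1 / 2 by norm_num] using h1
  have hwt : ∀ k < N, ExpBound (D.law k) (fun x => weight D N k ρ 1 * D.L x ^ (1 - D.α))
      (weight D N k ρ 1 / D.LamN N * M) := by
    intro k hk
    have := hD.isProbabilityMeasure_law k
    have h1 := (hmom k hk.le).const_mul (by fun_prop) (p := weight D N k ρ 1 / D.LamN N)
      (div_nonneg (hD.weight_nonneg N k ρ 1) hΛ.le)
      ((div_le_one hΛ).2 (hD.weight_le_LamN hk hρ hρN))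
    refine h1.mono fun x => le_of_eq ?_
    field_simp
  have h := hD.expBound_law_of_lipschitz N ρ 1 C f (fun k => weight D N k ρ 1 / D.LamN N * M)
    hρ zero_le_one (fun x y => by simpa [Real.dist_eq, dist_eq_norm] using hf.dist_le_mul x y)
    hf.continuous.measurable hC hwt
  refine h.mono_right (add_le_add_right ?_ _)
  have hterm : ∀ k ∈ range N, weight D N k ρ 1 / D.LamN N * M /
      ((1 + wt k) * (holderProd N / holderProd (k + 1))) ≤
      2 * D.phiConstHalf N * (ρ / D.lamStar N) ^ 2 *
        (D.γ (k + 1) ^ 2 * (D.Pi1 N / D.Pi1 k)) := by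
    intro k _
    have hw := wt_pos k
    have hR : 0 < holderProd N / holderProd (k + 1) :=
      div_pos (holderProd_pos N) (holderProd_pos (k + 1))
    have hP := hD.Pi1_div_nonneg N (k + 1)
    have e1 : weight D N k ρ 1 / D.LamN N * M /
        ((1 + wt k) * (holderProd N / holderProd (k + 1))) =
        1 / 4 * (ρ / D.lamStar N) ^ 2 * M * D.γ (k + 1) ^ 2 *
          ((holderProd N / holderProd (k + 1)) * (D.Pi1 N / D.Pi1 (k + 1))) := by
      rw [← hD.lamStar_sq N, weight]
      generalize holderProd N / holderProd (k + 1) = R at hR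
      generalize D.Pi1 N / D.Pi1 (k + 1) = π
      field_simp
    rw [e1, phiConstHalf, ← hM]
    calc 1 / 4 * (ρ / D.lamStar N) ^ 2 * M * D.γ (k + 1) ^ 2 *
          ((holderProd N / holderProd (k + 1)) * (D.Pi1 N / D.Pi1 (k + 1)))
        ≤ 1 / 4 * (ρ / D.lamStar N) ^ 2 * M * D.γ (k + 1) ^ 2 *
          (Real.exp (wtSum N) * (2 * (D.Pi1 N / D.Pi1 k))) := by
          gcongr
          · exact holderProd_div_le_exp N (k + 1)
          · exact hD.Pi1_div_succ_le N k
      _ = _ := by ring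
  refine (sum_le_sum hterm).trans ?_
  rw [← mul_sum]
  have hφ : 0 ≤ D.phiConstHalf N := mul_nonneg (by positivity) hM0
  have hrC : 0 ≤ D.rateC N :=
    sum_nonneg fun k _ => mul_nonneg (sq_nonneg _) (hD.Pi1_div_nonneg N k)
  have h1 : 0 < 1 - ρ * D.sTilde N / D.lamStar N := by
    rw [sub_pos, div_lt_one hl]; exact hρN
  have h2 : 1 - ρ * D.sTilde N / D.lamStar N ≤ 1 := by
    have := div_nonneg (mul_nonneg hρ (hD.sTilde_nonneg N)) hl.le
    linarith
  -- The sum is already bounded without a denominator; dividing by a number in `(0, 1]` only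
  -- enlarges the bound to the stated form.
  have h3 : (ρ / D.lamStar N) ^ 2 ≤
      (ρ / D.lamStar N) ^ 2 / (1 - ρ * D.sTilde N / D.lamStar N) :=
    le_div_self (sq_nonneg _) h1 h2
  calc 2 * D.phiConstHalf N * (ρ / D.lamStar N) ^ 2 *
        ∑ k ∈ range N, D.γ (k + 1) ^ 2 * (D.Pi1 N / D.Pi1 k)
      = 2 * D.phiConstHalf N * D.rateC N * (ρ / D.lamStar N) ^ 2 := by rw [rateC]; ring
    _ ≤ _ := by gcongr

/-! ### The transport-entropy inequalities. -/

theorem transport_Phi (hD : D.Standing) (hα : 1 / 2 < D.α) (N : ℕ) :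
    SatisfiesTransportEntropy (monotoneConj (D.Phi N)) (D.law N) := by
  have := hD.isProbabilityMeasure_law N
  refine satisfiesTransportEntropy_of_laplace (hD.integrable_norm_law N) ?_ ?_
  · have h2α : 0 < 2 * D.α - 1 := by linarith
    have hα0 := hD.α_pos
    have : 2 * D.α / (2 * D.α - 1) ≠ 0 := by positivity
    simp [Phi, Real.zero_rpow this]
  · rintro ρ - -
    refine ⟨_, rfl, fun f hf ⟨C, hC⟩ => ?_⟩
    have := hf.continuous.measurable
    exact (hD.expBound_law_Phi hα N ρ.2 hf hC).integral_le (by fun_prop)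

theorem transport_PhiHalf (hD : D.Standing) (hα : D.α = 1 / 2) (N : ℕ) :
    SatisfiesTransportEntropy (monotoneConj (D.PhiHalf N)) (D.law N) := by
  have := hD.isProbabilityMeasure_law N
  refine satisfiesTransportEntropy_of_laplace (hD.integrable_norm_law N) ?_ ?_
  · simp [PhiHalf, hD.lamStar_pos N]
  · intro ρ _ hρ
    have hlt : (ρ : ℝ) * D.sTilde N < D.lamStar N := by
      by_contra hlt
      simp [PhiHalf, hlt] at hρ
    refine ⟨_, if_pos hlt, fun f hf ⟨C, hC⟩ => ?_⟩
    have := hf.continuous.measurable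
    exact (hD.expBound_law_PhiHalf hα N ρ.2 hlt hf hC).integral_le (by fun_prop)

end Standing
end RMData

theorem mainTheorem2 {d q : ℕ} (hd : 0 < d) (D : RMData d q)
    {Ω : Type*} [MeasurableSpace Ω] (P : Measure Ω) [IsProbabilityMeasure P]
    (U : ℕ → Ω → EuclideanSpace ℝ (Fin q))
    (hUmeas : ∀ n, Measurable (U (n + 1)))
    (hUindep : iIndepFun (fun n => U (n + 1)) P)
    (hUlaw : ∀ n, P.map (U (n + 1)) = D.μ)
    (hHmeas : Measurable (Function.uncurry D.H))
    (hα : D.α ∈ Set.Icc (1 / 2 : ℝ) 1)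
    (hHL : D.HL) (hHLS : D.HLS) (hHUA : D.HUA)
    (hStep : D.StepCondition)
    (hβ : 0 < D.β) (hGC : GaussianConcentration D.β D.μ)
    (N : ℕ) (hN : 1 ≤ N) :
    (1 / 2 < D.α →
      SatisfiesTransportEntropy (monotoneConj (D.Phi N)) (P.map (D.iter U N))) ∧
    (D.α = 1 / 2 →
      SatisfiesTransportEntropy (monotoneConj (D.PhiHalf N)) (P.map (D.iter U N))) := by
  have hprob : IsProbabilityMeasure D.μ := by
    rw [← hUlaw 0]
    exact Measure.isProbabilityMeasure_map (hUmeas 0).aemeasurable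
  have hD : D.Standing :=
    ⟨hd, hprob, hHmeas, hα, hHL, hHLS, hHUA, hStep.1, hβ, hGC⟩
  rw [hD.map_iter_eq_law hUmeas hUindep hUlaw N]
  exact ⟨fun h => hD.transport_Phi h N, fun h => hD.transport_PhiHalf h N⟩
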